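/- Let $n\ge 2$ and let $\theta=(\theta_{jk})$ be a real antisymmetric $n\times n$ matrix with columns $\theta_1,\dots,\theta_n$. Let $A_\theta$ be the $C^*$-algebra of operators on $L^2(\mathbb T^n)$, $\mathbb T^n=\mathbb R^n/2\pi\mathbb Z^n$, generated by the unitaries $(U_j\xi)(x)=e^{ix_j}\xi(x+\pi\theta_j)$, $j=1,\dots,n$; let $\tau(a)=(2\pi)^{-n}\int_{\mathbb T^n}(a1)(x)\,dx$ be its standard tracial state, and let $\mathscr H_\theta$ be the Hilbert space of the GNS representation of $\tau$, on which $A_\theta$ acts by left multiplication. Let $\alpha$ be the action of $\mathbb R^n$ on $A_\theta$ induced by translations of $\mathbb T^n$ (so $\alpha_s(U_j)=e^{is_j}U_j$), let $\mathscr A_\theta$ be the algebra of all $u\in A_\theta$ such that $s\mapsto\alpha_s(u)$ is $C^\infty$, and let $\delta_j(u)=\frac1i\partial_{s_j}\alpha_s(u)|_{s=0}$ for $u\in\mathscr A_\theta$. Let $\Delta=\delta_1^2+\dots+\delta_n^2$ be the flat Laplacian on $\mathscr A_\theta\subset\mathscr H_\theta$, and let $\Delta^{-n/2}=\sum_{\mu>0}\mu^{-n/2}\,\Pi_\mu$,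 where $\Pi_\mu$ is the orthogonal projection of $\mathscr H_\theta$ onto the eigenspace of $\Delta$ for the eigenvalue $\mu$ (so $\Delta^{-n/2}$ vanishes on $\ker\Delta=\mathbb C\cdot 1$). For a Hilbert space $\mathscr H$ let $\mathscr L^{1,\infty}$ be the ideal of compact operators $T$ on $\mathscr H$ whose singular values satisfy $\mu_k(T)=\mathrm O(k^{-1})$. A normalized positive trace on $\mathscr L^{1,\infty}$ is a linear form $\varphi:\mathscr L^{1,\infty}\to\mathbb C$ that vanishes on all commutators $[A,T]$ with $A$ bounded and $T\in\mathscr L^{1,\infty}$, is non-negative on positive operators, and satisfies $\varphi(T_0)=1$, where $T_0$ is any operator that is diagonal in an orthonormal basis with eigenvalues $1,\frac12,\frac13,\dots$. An operator $T\in\mathscr L^{1,\infty}$ is strongly measurable if there is $L\in\mathbb C$ such that $\varphi(T)=L$ for every normalized positive trace $\varphi$ on $\mathscr L^{1,\infty}$; this value is its noncommutative integral ${\int\!\!\!\!\!-}\,T:=L$. Then, for every $a\in A_\theta$, the operator $a\Delta^{-n/2}$ on $\mathscr H_\theta$ is in $\mathscr L^{1,\infty}$ and strongly measurable, and $${\int\!\!\!\!\!\!-}\;a\Delta^{-n/2}=\hat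 c_n\,\tau(a),\qquad \hat c_n:=\frac1n\,|\mathbb S^{n-1}|,$$ where $|\mathbb S^{n-1}|$ is the surface area of the unit sphere of $\mathbb R^n$. -/

import Mathlib

open scoped ComplexOrder InnerProductSpace ENNReal ContDiff
open MeasureTheory

noncomputable section

namespace WeakTrace

variable {H : Type*} [NormedAddCommGroup H] [InnerProductSpace ℂ H]

/-- The norm of the restriction of `T` to the orthogonal complement of `E`. -/
def restrNorm (T : H →L[ℂ] H) (E : Submodule ℂ H) : ℝ := ‖T ∘L Eᗮ.subtypeL‖

/-- The `k`-th characteristic value (singular value)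
`μ_k(T) = inf {‖T|_{Eᗮ}‖ ; dim E ≤ k}`. As `‖T|_{Eᗮ}‖` decreases when `E` grows, on a space of
dimension at least `k` this is the infimum over the subspaces of dimension exactly `k`. -/
def mu (T : H →L[ℂ] H) (k : ℕ) : ℝ :=
  sInf {c : ℝ | ∃ E : Submodule ℂ H, FiniteDimensional ℂ E ∧ Module.finrank ℂ E ≤ k ∧
    c = restrNorm T E}

theorem restrNorm_nonneg (T : H →L[ℂ] H) (E : Submodule ℂ H) : 0 ≤ restrNorm T E := by
  exact norm_nonneg (T ∘L Eᗮ.subtypeL)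

theorem norm_apply_le_restrNorm (T : H →L[ℂ] H) (E : Submodule ℂ H) {x : H} (hx : x ∈ Eᗮ) :
    ‖T x‖ ≤ restrNorm T E * ‖x‖ :=
  (T ∘L Eᗮ.subtypeL).le_opNorm ⟨x, hx⟩

theorem restrNorm_le (T : H →L[ℂ] H) (E : Submodule ℂ H) {c : ℝ} (hc : 0 ≤ c)
    (h : ∀ x ∈ Eᗮ, ‖T x‖ ≤ c * ‖x‖) : restrNorm T E ≤ c :=
  ContinuousLinearMap.opNorm_le_bound _ hc fun x => h x x.2

theorem mu_le (T : H →L[ℂ] H) (E : Submodule ℂ H) [FiniteDimensional ℂ E] {k : ℕ}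
    (h : Module.finrank ℂ E ≤ k) : mu T k ≤ restrNorm T E :=
  csInf_le ⟨0, by rintro _ ⟨E, -, -, rfl⟩; exact restrNorm_nonneg T E⟩ ⟨E, inferInstance, h, rfl⟩

theorem mu_nonneg (T : H →L[ℂ] H) (k : ℕ) : 0 ≤ mu T k :=
  Real.sInf_nonneg (by rintro _ ⟨E, -, -, rfl⟩; exact restrNorm_nonneg T E)

theorem exists_restrNorm_lt (T : H →L[ℂ] H) (k : ℕ) {ε : ℝ} (hε : 0 < ε) :
    ∃ E : Submodule ℂ H, FiniteDimensional ℂ E ∧ Module.finrank ℂ E ≤ k ∧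
      restrNorm T E < mu T k + ε := by
  obtain ⟨_, ⟨E, h1, h2, rfl⟩, h⟩ := exists_lt_of_csInf_lt
    (s := {c : ℝ | ∃ E : Submodule ℂ H, FiniteDimensional ℂ E ∧ Module.finrank ℂ E ≤ k ∧
      c = restrNorm T E})
    ⟨_, ⊥, inferInstance, by simp, rfl⟩ (lt_add_of_pos_right (mu T k) hε)
  exact ⟨E, h1, h2, h⟩

theorem mu_add_le (S T : H →L[ℂ] H) (k l : ℕ) : mu (S + T) (k + l) ≤ mu S k + mu T l := by
  refine le_of_forall_pos_le_add fun ε hε => ?_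
  obtain ⟨E, _, hE, hE'⟩ := exists_restrNorm_lt S k (half_pos hε)
  obtain ⟨F, _, hF, hF'⟩ := exists_restrNorm_lt T l (half_pos hε)
  have h1 : Module.finrank ℂ ↥(E ⊔ F) ≤ k + l :=
    (Submodule.finrank_add_le_finrank_add_finrank E F).trans (add_le_add hE hF)
  have h2 : restrNorm (S + T) (E ⊔ F) ≤ restrNorm S E + restrNorm T F := by
    refine restrNorm_le _ _ (add_nonneg (restrNorm_nonneg _ _) (restrNorm_nonneg _ _)) ?_
    intro x hx
    rw [add_mul]
    exact (norm_add_le _ _).trans (add_le_add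
      (norm_apply_le_restrNorm S E (Submodule.orthogonal_le le_sup_left hx))
      (norm_apply_le_restrNorm T F (Submodule.orthogonal_le le_sup_right hx)))
  linarith [mu_le (S + T) (E ⊔ F) h1]

theorem mu_antitone (T : H →L[ℂ] H) {k l : ℕ} (h : k ≤ l) : mu T l ≤ mu T k := by
  refine le_of_forall_pos_le_add fun ε hε => ?_
  obtain ⟨E, _, hE, hE'⟩ := exists_restrNorm_lt T k hε
  exact (mu_le T E (hE.trans h)).trans hE'.le

theorem mu_comp_left_le (A T : H →L[ℂ] H) (k : ℕ) : mu (A ∘L T) k ≤ ‖A‖ * mu T k := by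
  refine le_of_forall_pos_le_add fun ε hε => ?_
  obtain ⟨E, _, hE, hE'⟩ := exists_restrNorm_lt T k
    (show 0 < ε / (‖A‖ + 1) by positivity)
  have h2 : restrNorm (A ∘L T) E ≤ ‖A‖ * restrNorm T E := by
    refine restrNorm_le _ _ (mul_nonneg (norm_nonneg _) (restrNorm_nonneg _ _)) fun x hx => ?_
    rw [mul_assoc]
    exact (A.le_opNorm _).trans
      (mul_le_mul_of_nonneg_left (norm_apply_le_restrNorm T E hx) (norm_nonneg _))
  have h3 : ‖A‖ * (ε / (‖A‖ + 1)) ≤ ε := by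
    rw [mul_div_assoc', div_le_iff₀ (by positivity)]
    nlinarith [norm_nonneg A]
  nlinarith [mu_le (A ∘L T) E hE, norm_nonneg A,
    mul_le_mul_of_nonneg_left hE'.le (norm_nonneg A)]

theorem mu_comp_right_le [CompleteSpace H] (T A : H →L[ℂ] H) (k : ℕ) :
    mu (T ∘L A) k ≤ mu T k * ‖A‖ := by
  refine le_of_forall_pos_le_add fun ε hε => ?_
  obtain ⟨E, _, hE, hE'⟩ := exists_restrNorm_lt T k
    (show 0 < ε / (‖A‖ + 1) by positivity)
  let F : Submodule ℂ H := E.map (ContinuousLinearMap.adjoint A).toLinearMap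
  have hF : Module.finrank ℂ F ≤ k := (Submodule.finrank_map_le _ _).trans hE
  have h2 : restrNorm (T ∘L A) F ≤ restrNorm T E * ‖A‖ := by
    refine restrNorm_le _ _ (mul_nonneg (restrNorm_nonneg _ _) (norm_nonneg _)) fun x hx => ?_
    have hAx : A x ∈ Eᗮ := by
      rw [Submodule.mem_orthogonal] at hx ⊢
      intro u hu
      rw [← ContinuousLinearMap.adjoint_inner_left]
      exact hx _ (Submodule.mem_map_of_mem hu)
    rw [mul_assoc]
    exact (norm_apply_le_restrNorm T E hAx).trans
      (mul_le_mul_of_nonneg_left (A.le_opNorm _) (restrNorm_nonneg _ _))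
  have h3 : (ε / (‖A‖ + 1)) * ‖A‖ ≤ ε := by
    rw [div_mul_eq_mul_div, div_le_iff₀ (by positivity)]
    nlinarith [norm_nonneg A]
  nlinarith [mu_le (T ∘L A) F hF, norm_nonneg A,
    mul_le_mul_of_nonneg_right hE'.le (norm_nonneg A)]

variable [CompleteSpace H]

/-- The weak trace class `ℒ^{1,∞}`: the compact operators `T` with `μ_k(T) = O(1/k)`. -/
def weakTraceClass (H : Type*) [NormedAddCommGroup H] [InnerProductSpace ℂ H] [CompleteSpace H] :
    Submodule ℂ (H →L[ℂ] H) where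
  carrier := {T | IsCompactOperator T ∧ ∃ C : ℝ, ∀ k : ℕ, mu T k ≤ C / (k + 1)}
  zero_mem' := by
    refine ⟨isCompactOperator_zero, 0, fun k => ?_⟩
    refine (mu_le 0 ⊥ (by simp)).trans (restrNorm_le _ _ (by simp) fun x _ => ?_)
    simp
  add_mem' := by
    rintro S T ⟨hS, C, hC⟩ ⟨hT, D, hD⟩
    refine ⟨hS.add hT, 2 * (C + D), fun k => ?_⟩
    have hCD : 0 ≤ C + D := by
      have h1 := (mu_nonneg S 0).trans (hC 0)
      have h2 := (mu_nonneg T 0).trans (hD 0)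
      simp at h1 h2
      linarith
    have h1 : mu (S + T) k ≤ mu S (k / 2) + mu T (k / 2) :=
      (mu_antitone _ (by omega)).trans (mu_add_le S T (k / 2) (k / 2))
    have h2 : ((k : ℝ) + 1) ≤ 2 * (((k / 2 : ℕ) : ℝ) + 1) := by
      have : k + 1 ≤ 2 * (k / 2 + 1) := by omega
      exact_mod_cast this
    calc mu (S + T) k ≤ (C + D) / (((k / 2 : ℕ) : ℝ) + 1) := by
          rw [add_div]; exact h1.trans (add_le_add (hC _) (hD _))
      _ ≤ 2 * (C + D) / (k + 1) := by
          rw [div_le_div_iff₀ (by positivity) (by positivity)]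
          nlinarith
  smul_mem' := by
    rintro c T ⟨hT, C, hC⟩
    refine ⟨hT.smul c, ‖c • ContinuousLinearMap.id ℂ H‖ * C, fun k => ?_⟩
    have h : c • T = (c • ContinuousLinearMap.id ℂ H) ∘L T := by ext; simp
    rw [h, mul_div_assoc]
    exact (mu_comp_left_le _ _ _).trans (mul_le_mul_of_nonneg_left (hC k) (norm_nonneg _))

theorem comp_left_mem (A : H →L[ℂ] H) {T : H →L[ℂ] H} (hT : T ∈ weakTraceClass H) :
    A ∘L T ∈ weakTraceClass H := by
  obtain ⟨hT, C, hC⟩ := hT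
  refine ⟨hT.clm_comp A, ‖A‖ * C, fun k => ?_⟩
  rw [mul_div_assoc]
  exact (mu_comp_left_le _ _ _).trans (mul_le_mul_of_nonneg_left (hC k) (norm_nonneg _))

theorem comp_right_mem (A : H →L[ℂ] H) {T : H →L[ℂ] H} (hT : T ∈ weakTraceClass H) :
    T ∘L A ∈ weakTraceClass H := by
  obtain ⟨hT, C, hC⟩ := hT
  refine ⟨hT.comp_clm A, C * ‖A‖, fun k => ?_⟩
  rw [mul_div_right_comm]
  exact (mu_comp_right_le _ _ _).trans (mul_le_mul_of_nonneg_right (hC k) (norm_nonneg _))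

/-- The commutator `[A, T]` of a bounded operator and a weak trace class operator. -/
def commutator (A : H →L[ℂ] H) (T : weakTraceClass H) : weakTraceClass H :=
  ⟨A ∘L (T : H →L[ℂ] H) - (T : H →L[ℂ] H) ∘L A,
    Submodule.sub_mem _ (comp_left_mem A T.2) (comp_right_mem A T.2)⟩

/-- `T` is diagonal in some orthonormal basis `(ξ_k)_{k ≥ 0}` with `T ξ_k = (k+1)⁻¹ ξ_k`. -/
def IsHarmonic (T : H →L[ℂ] H) : Prop :=
  ∃ ξ : HilbertBasis ℕ ℂ H, ∀ k : ℕ, T (ξ k) = ((k : ℂ) + 1)⁻¹ • ξ k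

/-- Normalized positive traces on `ℒ^{1,∞}`: linear forms that vanish on all commutators
`[A, T]`, are non-negative on positive operators, and take the value `1` on an operator with
eigenvalue sequence `1, 1/2, 1/3, …`; all such operators are unitarily equivalent, and so the
choice does not matter. -/
structure IsNormalizedPositiveTrace (φ : weakTraceClass H →ₗ[ℂ] ℂ) : Prop where
  map_commutator : ∀ (A : H →L[ℂ] H) (T : weakTraceClass H), φ (commutator A T) = 0
  nonneg : ∀ T : weakTraceClass H, (T : H →L[ℂ] H).IsPositive → 0 ≤ φ T
  normalized : ∃ T₀ : weakTraceClass H, IsHarmonic (T₀ : H →L[ℂ] H) ∧ φ T₀ = 1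

/-- `T` belongs to `ℒ^{1,∞}` and every normalized positive trace on `ℒ^{1,∞}` takes the value `L`
at `T`, i.e. `T` is strongly measurable with noncommutative integral `⨍ T = L`. -/
def HasNCIntegral (T : H →L[ℂ] H) (L : ℂ) : Prop :=
  ∃ hT : T ∈ weakTraceClass H, ∀ φ : weakTraceClass H →ₗ[ℂ] ℂ,
    IsNormalizedPositiveTrace φ → φ ⟨T, hT⟩ = L

/-- Strongly measurable operators. -/
def IsStronglyMeasurable (T : H →L[ℂ] H) : Prop := ∃ L : ℂ, HasNCIntegral T L

end WeakTrace

namespace NCTorus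

variable {n : ℕ}

/-- The normalized Haar measure on `𝕋ⁿ = (ℝ/ℤ)ⁿ`; in the coordinates `x = 2πt ∈ (ℝ/2πℤ)ⁿ` it is
`(2π)⁻ⁿ dx`. -/
abbrev haar (n : ℕ) : Measure (UnitAddTorus (Fin n)) :=
  Measure.pi fun _ => AddCircle.haarAddCircle

/-- The Hilbert space `L²(𝕋ⁿ)`. -/
abbrev L2 (n : ℕ) : Type := Lp ℂ 2 (haar n)

/-- The algebra of bounded operators on `L²(𝕋ⁿ)`. -/
abbrev Op (n : ℕ) : Type := L2 n →L[ℂ] L2 n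

/-- The translation operator `(V_t ξ)(x) = ξ(x + t)`. -/
def shift (t : UnitAddTorus (Fin n)) : Op n :=
  (Lp.compMeasurePreservingₗᵢ ℂ (fun x => x + t)
    (measurePreserving_add_right (haar n) t)).toContinuousLinearMap

/-- Multiplication by a continuous function on `L²(𝕋ⁿ)`. -/
def mulOp (f : C(UnitAddTorus (Fin n), ℂ)) : Op n :=
  (ContinuousLinearMap.mul ℂ ℂ).holderL (haar n) ∞ 2 2 (f.toLp ∞ (haar n) ℂ)

theorem coeFn_shift (t : UnitAddTorus (Fin n)) (ξ : L2 n) :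
    shift t ξ =ᵐ[haar n] fun x => ξ (x + t) :=
  Lp.coeFn_compMeasurePreserving ξ (measurePreserving_add_right (haar n) t)

theorem coeFn_mulOp (f : C(UnitAddTorus (Fin n), ℂ)) (ξ : L2 n) :
    mulOp f ξ =ᵐ[haar n] fun x => f x * ξ x := by
  filter_upwards [ContinuousLinearMap.coeFn_holder (r := 2) (ContinuousLinearMap.mul ℂ ℂ)
    (f.toLp ∞ (haar n) ℂ) ξ, ContinuousMap.coeFn_toLp (p := ∞) (𝕜 := ℂ) (haar n) f] with x h1 h2
  rw [← h2]
  exact h1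

/-- The unitary operator `(U_j ξ)(x) = e^{i x_j} ξ(x + π θ_j)`, with `θ_j` the `j`-th column of `θ`;
in the coordinate `t = x / 2π` this is `e^{2π i t_j} ξ(t + θ_j / 2)`. -/
def U (θ : Matrix (Fin n) (Fin n) ℝ) (j : Fin n) : Op n :=
  mulOp (UnitAddTorus.mFourier (Pi.single j 1)) ∘L
    shift (fun l => ((θ l j / 2 : ℝ) : UnitAddCircle))

/-- The C*-algebra generated by `U_1, …, U_n`, as a *-subalgebra of the bounded operators on
`L²(𝕋ⁿ)`. -/
def algebraOf (θ : Matrix (Fin n) (Fin n) ℝ) : StarSubalgebra ℂ (Op n) :=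
  (StarAlgebra.adjoin ℂ (Set.range (U θ))).topologicalClosure

theorem shift_add (s t : UnitAddTorus (Fin n)) : shift (s + t) = shift s ∘L shift t := by
  ext1 ξ
  apply Lp.ext
  have h := (measurePreserving_add_right (haar n) s).quasiMeasurePreserving.ae (coeFn_shift t ξ)
  filter_upwards [coeFn_shift (s + t) ξ, coeFn_shift s (shift t ξ), h] with x h1 h2 h3
  rw [h1, ContinuousLinearMap.comp_apply, h2, h3, add_assoc]

theorem shift_zero : shift (0 : UnitAddTorus (Fin n)) = 1 := by
  ext1 ξ
  apply Lp.ext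
  filter_upwards [coeFn_shift 0 ξ] with x h1
  rw [h1, add_zero]
  rfl

theorem star_shift (t : UnitAddTorus (Fin n)) : star (shift t) = shift (-t) := by
  have h1 : star (shift t) * shift t = 1 := by
    rw [ContinuousLinearMap.star_eq_adjoint]
    exact (ContinuousLinearMap.norm_map_iff_adjoint_comp_self _).1 fun ξ =>
      (Lp.compMeasurePreservingₗᵢ ℂ (fun x => x + t)
        (measurePreserving_add_right (haar n) t)).norm_map ξ
  have h2 : shift t * shift (-t) = 1 := by
    rw [← shift_zero, ← add_neg_cancel t, shift_add]; rfl
  exact left_inv_eq_right_inv h1 h2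

/-- The translation operator as a unitary. -/
def shiftU (t : UnitAddTorus (Fin n)) : unitary (Op n) :=
  ⟨shift t, by
    rw [Unitary.mem_iff, star_shift]
    constructor
    · change shift (-t) ∘L shift t = 1
      rw [← shift_add, neg_add_cancel, shift_zero]
    · change shift t ∘L shift (-t) = 1
      rw [← shift_add, add_neg_cancel, shift_zero]⟩

/-- The point of `𝕋ⁿ = (ℝ/ℤ)ⁿ` that corresponds to `s ∈ ℝⁿ` modulo `2πℤⁿ`. -/
def angle (s : Fin n → ℝ) : UnitAddTorus (Fin n) := fun j => ((s j / (2 * Real.pi) : ℝ) : UnitAddCircle)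

theorem angle_add (s t : Fin n → ℝ) : angle (s + t) = angle s + angle t := by
  funext j
  simp [angle, add_div]

theorem angle_zero : angle (0 : Fin n → ℝ) = 0 := by
  funext j
  simp [angle]

/-- The action of `ℝⁿ` on operators that is induced by the translations: `T ↦ V_s T V_s⁻¹`. -/
def conj (s : Fin n → ℝ) : Op n ≃⋆ₐ[ℂ] Op n := Unitary.conjStarAlgAut ℂ (Op n) (shiftU (angle s))

theorem conj_apply (s : Fin n → ℝ) (T : Op n) :
    conj s T = shift (angle s) * T * shift (-angle s) := by
  rw [conj, Unitary.conjStarAlgAut_apply]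
  change shift (angle s) * T * star (shift (angle s)) = _
  rw [star_shift]

theorem continuous_conj (s : Fin n → ℝ) : Continuous (conj (n := n) s) := by
  have : (conj (n := n) s : Op n → Op n) = fun T => shift (angle s) * T * shift (-angle s) :=
    funext (conj_apply s)
  rw [this]
  fun_prop

theorem conj_conj (s t : Fin n → ℝ) (T : Op n) : conj s (conj t T) = conj (s + t) T := by
  have h : shift (angle (s + t)) = shift (angle s) * shift (angle t) := by
    rw [angle_add, shift_add]; rfl
  have h' : shift (-angle (s + t)) = shift (-angle t) * shift (-angle s) := by
    rw [angle_add, neg_add_rev, shift_add]; rfl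
  simp only [conj_apply, h, h', mul_assoc]

theorem conj_U (s : Fin n → ℝ) (θ : Matrix (Fin n) (Fin n) ℝ) (j : Fin n) :
    conj s (U θ j) = Complex.exp (Complex.I * s j) • U θ j := by
  have h1 : shift (angle s) ∘L mulOp (UnitAddTorus.mFourier (Pi.single j 1)) =
      (Complex.exp (Complex.I * s j)) •
        (mulOp (UnitAddTorus.mFourier (Pi.single j 1)) ∘L shift (angle s)) := by
    ext1 ξ
    apply Lp.ext
    have h := (measurePreserving_add_right (haar n) (angle s)).quasiMeasurePreserving.ae
      (coeFn_mulOp (UnitAddTorus.mFourier (Pi.single j 1)) ξ)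
    have h' := coeFn_mulOp (UnitAddTorus.mFourier (Pi.single j 1)) (shift (angle s) ξ)
    have h'' := Lp.coeFn_smul (Complex.exp (Complex.I * s j))
      (mulOp (UnitAddTorus.mFourier (Pi.single j 1)) (shift (angle s) ξ))
    filter_upwards [coeFn_shift (angle s) (mulOp (UnitAddTorus.mFourier (Pi.single j 1)) ξ), h, h',
      h'', coeFn_shift (angle s) ξ] with x e1 e2 e3 e4 e5
    simp only [ContinuousLinearMap.comp_apply, _root_.smul_apply]
    rw [e1, e2, e4, Pi.smul_apply, e3, e5]
    have key : UnitAddTorus.mFourier (Pi.single j 1) (x + angle s) =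
        Complex.exp (Complex.I * s j) * UnitAddTorus.mFourier (Pi.single j 1) x := by
      rw [UnitAddTorus.mFourier_single, UnitAddTorus.mFourier_single]
      simp only [Pi.add_apply, angle]
      rw [fourier_one, fourier_one, AddCircle.toCircle_add, Circle.coe_mul, mul_comm]
      congr 1
      rw [AddCircle.toCircle_apply_mk, Circle.coe_exp]
      congr 1
      push_cast
      field_simp
    rw [key, smul_eq_mul, mul_assoc]
  rw [conj_apply]
  have h2 : shift (angle s) * U θ j * shift (-angle s) =
      (shift (angle s) ∘L mulOp (UnitAddTorus.mFourier (Pi.single j 1))) ∘L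
        (shift (fun l => ((θ l j / 2 : ℝ) : UnitAddCircle)) ∘L shift (-angle s)) := rfl
  rw [h2, h1, ContinuousLinearMap.smul_comp]
  congr 1
  rw [ContinuousLinearMap.comp_assoc, ← shift_add, ← shift_add, U]
  congr 2
  abel

theorem conj_mem (s : Fin n → ℝ) (θ : Matrix (Fin n) (Fin n) ℝ) {T : Op n}
    (hT : T ∈ algebraOf θ) : conj s T ∈ algebraOf θ := by
  let A : StarSubalgebra ℂ (Op n) := (algebraOf θ).comap (conj s).toStarAlgHom
  have hA : IsClosed (A : Set (Op n)) :=
    (StarSubalgebra.isClosed_topologicalClosure _).preimage (continuous_conj s)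
  have h : algebraOf θ ≤ A := by
    refine StarSubalgebra.topologicalClosure_minimal (StarAlgebra.adjoin_le ?_) hA
    rintro _ ⟨j, rfl⟩
    change conj s (U θ j) ∈ algebraOf θ
    rw [conj_U]
    exact SMulMemClass.smul_mem _ (StarSubalgebra.le_topologicalClosure _
      (StarAlgebra.subset_adjoin ℂ _ ⟨j, rfl⟩))
  exact h hT

end NCTorus

/-- The noncommutative torus `A_θ = C(𝕋ⁿ_θ)`: the C*-algebra generated by the unitaries `U_j`. -/
def NCTorus {n : ℕ} (θ : Matrix (Fin n) (Fin n) ℝ) : Type := NCTorus.algebraOf θ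

namespace NCTorus

variable {n : ℕ} (θ : Matrix (Fin n) (Fin n) ℝ)

instance : IsClosed (algebraOf θ : Set (Op n)) := StarSubalgebra.isClosed_topologicalClosure _

instance : CStarAlgebra (NCTorus θ) := inferInstanceAs (CStarAlgebra (algebraOf θ))

/-- The order of the C*-algebra `A_θ`: `a ≤ b` when `b - a` is selfadjoint with non-negative
spectrum. -/
instance : PartialOrder (NCTorus θ) := CStarAlgebra.spectralOrder _

instance : StarOrderedRing (NCTorus θ) := CStarAlgebra.spectralOrderedRing _

/-- The inclusion of `A_θ` in the bounded operators on `L²(𝕋ⁿ)`. -/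
def toOp : NCTorus θ →⋆ₐ[ℂ] Op n := (algebraOf θ).subtype

/-- The constant function `1` in `L²(𝕋ⁿ)`. -/
def one2 (n : ℕ) : L2 n := ContinuousMap.toLp 2 (haar n) ℂ 1

/-- The tracial state `τ(a) = ⟨a 1, 1⟩` of `A_θ`. -/
def tau : NCTorus θ →ₚ[ℂ] ℂ :=
  .mk₀ { toFun := fun a => ⟪one2 n, toOp θ a (one2 n)⟫_ℂ
         map_add' := fun a b => by simp [inner_add_right]
         map_smul' := fun c a => by simp [inner_smul_right] } fun a ha => by
    obtain ⟨b, rfl⟩ := CStarAlgebra.nonneg_iff_eq_star_mul_self.1 ha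
    have : ⟪one2 n, toOp θ (star b * b) (one2 n)⟫_ℂ =
        ⟪toOp θ b (one2 n), toOp θ b (one2 n)⟫_ℂ := by
      rw [map_mul, map_star, mul_apply_eq_comp, ContinuousLinearMap.star_eq_adjoint,
        ContinuousLinearMap.adjoint_inner_right]
    change 0 ≤ ⟪one2 n, toOp θ (star b * b) (one2 n)⟫_ℂ
    rw [this, inner_self_eq_norm_sq_to_K]
    exact Complex.zero_le_real.2 (sq_nonneg _) |>.trans_eq (Complex.ofReal_pow _ _)

/-- The Hilbert space `ℋ_θ = L²(𝕋ⁿ_θ)` of the GNS representation of `τ`. -/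
abbrev Hilb : Type := (tau θ).GNS

/-- The canonical map `A_θ → ℋ_θ`. -/
def toHilb : NCTorus θ →ₗ[ℂ] Hilb θ :=
  (UniformSpace.Completion.toComplₗᵢ (𝕜 := ℂ) (E := (tau θ).PreGNS)).toLinearMap ∘ₗ
    (tau θ).toPreGNS.toLinearMap

/-- The GNS representation of `A_θ` in `ℋ_θ`, by left multiplication. -/
def leftMul : NCTorus θ →⋆ₐ[ℂ] (Hilb θ →L[ℂ] Hilb θ) := (tau θ).gnsStarAlgHom

/-- The action `α` of `ℝⁿ` on `A_θ` that is induced by the translations of `𝕋ⁿ`. -/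
def alpha (s : Fin n → ℝ) : NCTorus θ →L[ℂ] NCTorus θ where
  toFun a := (⟨conj s (toOp θ a), conj_mem s θ a.2⟩ : algebraOf θ)
  map_add' a b := Subtype.ext ((congrArg (conj s) (map_add (toOp θ) a b)).trans (map_add (conj s) _ _))
  map_smul' c a := Subtype.ext ((congrArg (conj s) (map_smul (toOp θ) c a)).trans (map_smul (conj s) _ _))
  cont := ((continuous_conj s).comp continuous_subtype_val).subtype_mk _

theorem toOp_alpha (s : Fin n → ℝ) (a : NCTorus θ) : toOp θ (alpha θ s a) = conj s (toOp θ a) := rfl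

theorem alpha_alpha (s t : Fin n → ℝ) (a : NCTorus θ) :
    alpha θ s (alpha θ t a) = alpha θ (s + t) a :=
  Subtype.ext (conj_conj s t (toOp θ a))

/-- The smooth noncommutative torus `C^∞(𝕋ⁿ_θ)`: the elements `u` of `A_θ` for which
`s ↦ α_s(u)` is a `C^∞` map from `ℝⁿ` to `A_θ`. -/
def smooth : Submodule ℂ (NCTorus θ) where
  carrier := {u | ContDiff ℝ ∞ fun s : Fin n → ℝ => alpha θ s u}
  zero_mem' := by simpa using contDiff_const
  add_mem' {u v} hu hv := by
    rw [Set.mem_ofPred_eq] at hu hv ⊢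
    simpa using hu.add hv
  smul_mem' c u hu := by
    rw [Set.mem_ofPred_eq] at hu ⊢
    simpa using hu.const_smul c

theorem contDiff_alpha {u : NCTorus θ} (hu : u ∈ smooth θ) :
    ContDiff ℝ ∞ fun s : Fin n → ℝ => alpha θ s u := hu

theorem differentiable_alpha {u : NCTorus θ} (hu : u ∈ smooth θ) :
    Differentiable ℝ fun s : Fin n → ℝ => alpha θ s u :=
  (contDiff_alpha θ hu).differentiable (by simp)

/-- The partial derivative of `s ↦ α_s(u)` in the direction of the `j`-th coordinate. -/
def partialAlpha (j : Fin n) (u : NCTorus θ) (s : Fin n → ℝ) : NCTorus θ :=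
  fderiv ℝ (fun s : Fin n → ℝ => alpha θ s u) s (Pi.single j 1)

theorem alpha_partialAlpha (j : Fin n) {u : NCTorus θ} (hu : u ∈ smooth θ) (s : Fin n → ℝ) :
    alpha θ s (partialAlpha θ j u 0) = partialAlpha θ j u s := by
  have hd : Differentiable ℝ fun s : Fin n → ℝ => alpha θ s u :=
    differentiable_alpha θ hu
  have h1 : HasFDerivAt (fun t : Fin n → ℝ => alpha θ s (alpha θ t u))
      (((alpha θ s).restrictScalars ℝ).comp (fderiv ℝ (fun s : Fin n → ℝ => alpha θ s u) 0)) 0 :=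
    ((alpha θ s).restrictScalars ℝ).hasFDerivAt.comp 0 (hd 0).hasFDerivAt
  have h2 : HasFDerivAt (fun t : Fin n → ℝ => alpha θ (s + t) u)
      (fderiv ℝ (fun s : Fin n → ℝ => alpha θ s u) s) 0 := by
    have := (hd (s + 0)).hasFDerivAt.comp (0 : Fin n → ℝ) ((hasFDerivAt_id 0).const_add s)
    simpa [Function.comp_def] using this
  simp only [alpha_alpha] at h1
  have := congrArg (fun L : (Fin n → ℝ) →L[ℝ] NCTorus θ => L (Pi.single j 1)) (h1.unique h2)
  simpa [partialAlpha] using this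

theorem partialAlpha_mem (j : Fin n) {u : NCTorus θ} (hu : u ∈ smooth θ) :
    partialAlpha θ j u 0 ∈ smooth θ := by
  change ContDiff ℝ ∞ fun s : Fin n → ℝ => alpha θ s (partialAlpha θ j u 0)
  simp only [alpha_partialAlpha θ j hu]
  exact ((contDiff_alpha θ hu).fderiv_right (m := ∞) (by simp)).clm_apply contDiff_const

/-- The derivation `δ_j(u) = (1/i) ∂_{s_j} α_s(u) |_{s = 0}` of the smooth noncommutative torus. -/
def delta (j : Fin n) : Module.End ℂ (smooth θ) where
  toFun u := ⟨(1 / Complex.I) • partialAlpha θ j u 0,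
    (smooth θ).smul_mem _ (partialAlpha_mem θ j u.2)⟩
  map_add' u v := by
    have hu : Differentiable ℝ fun s : Fin n → ℝ => alpha θ s u :=
      differentiable_alpha θ u.2
    have hv : Differentiable ℝ fun s : Fin n → ℝ => alpha θ s v :=
      differentiable_alpha θ v.2
    ext1
    simp [partialAlpha, fderiv_fun_add (hu 0) (hv 0)]
  map_smul' c u := by
    have hu : Differentiable ℝ fun s : Fin n → ℝ => alpha θ s u :=
      differentiable_alpha θ u.2
    ext1
    simp [partialAlpha, fderiv_fun_const_smul (hu 0), smul_comm c]

/-- The flat Laplacian `Δ = δ_1² + ⋯ + δ_n²` on the smooth noncommutative torus. -/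
def laplacian : Module.End ℂ (smooth θ) := ∑ j, delta θ j * delta θ j

/-- Let `D` be an operator in the Hilbert space `H`, with domain `V` (mapped to `H` by `ι`), that is
essentially selfadjoint with non-negative discrete spectrum. This is the power `D^{-s}`, `s > 0`,
in the sense of the functional calculus,
`D^{-s} = ∑_{μ > 0} μ^{-s} Π_μ`, with `Π_μ` the orthogonal projection onto the eigenspace of `D` for
the eigenvalue `μ`; by the usual convention `D^{-s}` vanishes on the kernel of `D`. The terms for
which `μ` is not an eigenvalue are zero, and the series converges in norm. -/
def negPower {V H : Type*} [AddCommGroup V] [Module ℂ V] [NormedAddCommGroup H]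
    [InnerProductSpace ℂ H] [CompleteSpace H] (D : Module.End ℂ V) (ι : V →ₗ[ℂ] H) (s : ℝ) :
    H →L[ℂ] H :=
  ∑' μ : {μ : ℝ // 0 < μ}, (((μ : ℝ) ^ (-s) : ℝ) : ℂ) •
    (((D.eigenspace ((μ : ℝ) : ℂ)).map ι).topologicalClosure).starProjection

/-- The operator `Δ^{-s}` on `ℋ_θ`, with `Δ` the flat Laplacian. -/
def laplacianNegPower (s : ℝ) : Hilb θ →L[ℂ] Hilb θ :=
  negPower (laplacian θ) (toHilb θ ∘ₗ (smooth θ).subtype) s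

end NCTorus

/-- The surface area `|𝕊^{n-1}|` of the unit sphere of `ℝⁿ`. -/
def sphereArea (n : ℕ) : ℝ := (volume : Measure (EuclideanSpace ℝ (Fin n))).toSphere.real Set.univ

end

/-! The Weyl operators `W_k`, `k ∈ ℤⁿ` (multiplication by the character `e_k` composed with a
translation depending on `k`), are the monomials in the `U_j` up to phases. They span a dense
subspace of `A_θ`, and their images in `ℋ_θ` form an orthonormal basis because `W_k 1 = e_k`. Since
`α_s` multiplies `W_k` by a character of `s`, this basis diagonalizes `Δ` with eigenvalues `|k|²`,
whatever `θ` is. So `Δ^{-n/2}` has the eigenvalues `|k|^{-n}`, `k ≠ 0`, and counting lattice points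
in balls shows that they decay like `|𝕊^{n-1}| / (n m)` (`exists_sorted_eigenvalues`).

Let `φ` be a normalized positive trace. It vanishes on finite-rank diagonal operators
(`map_single`), because the harmonic series diverges; comparison with multiples of the harmonic
operator then gives `φ(T) = L` for every diagonal `T` with real eigenvalues asymptotic to `L / m`
(`map_diagonal`). This settles `a = 1`.

For general `a`, the functional `a ↦ φ(a Δ^{-n/2})` is positive by the trace property, hence
automatically continuous on the C*-algebra `A_θ`, although `φ` itself is not assumed continuous.
Translations are implemented on `ℋ_θ` by operators commuting with `Δ^{-n/2}`, so the functional is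
translation invariant and kills every `W_k` with `k ≠ 0` (`traceFunctional_weyl`). It therefore
agrees with a multiple of `τ` on a dense subspace, hence everywhere (`traceFunctional_eq`). -/

noncomputable section

/-! ### Diagonal operators in a Hilbert basis -/

namespace HilbertBasis

variable {ι κ H : Type*} [NormedAddCommGroup H] [InnerProductSpace ℂ H]

/-- Two bounded operators that agree on a Hilbert basis are equal. -/
theorem clm_ext (b : HilbertBasis ι ℂ H) {S T : H →L[ℂ] H} (h : ∀ i, S (b i) = T (b i)) :
    S = T :=
  ContinuousLinearMap.ext_on (Submodule.dense_iff_topologicalClosure_eq_top.2 b.dense_span)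
    (by rintro _ ⟨i, rfl⟩; exact h i)

theorem hasSum_norm_sq (b : HilbertBasis ι ℂ H) (x : H) :
    HasSum (fun i => ‖⟪b i, x⟫_ℂ‖ ^ 2) (‖x‖ ^ 2) := by
  have h := Complex.hasSum_re (b.hasSum_inner_mul_inner x x)
  rw [← inner_self_eq_norm_sq (𝕜 := ℂ) x]
  refine h.congr_fun fun i => ?_
  rw [← inner_conj_symm x (b i), RCLike.conj_mul, ← RCLike.ofReal_pow]
  exact (RCLike.ofReal_re (K := ℂ) _).symm

/-- The bounded operator with given bounded eigenvalues on a Hilbert basis. -/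
theorem exists_diagonal (b : HilbertBasis ι ℂ H) (d : ι → ℂ) {C : ℝ} (hd : ∀ i, ‖d i‖ ≤ C) :
    ∃ T : H →L[ℂ] H, ∀ i, T (b i) = d i • b i := by
  classical
  have hd' : ∀ i, ‖d i • ContinuousLinearMap.id ℂ ℂ‖ ≤ max C 0 := fun i => by
    rw [norm_smul]
    simpa using Or.inl (hd i)
  let M : lp (fun _ : ι => ℂ) 2 →L[ℂ] lp (fun _ : ι => ℂ) 2 :=
    lp.mapCLM 2 (fun i => d i • ContinuousLinearMap.id ℂ ℂ) (le_max_right C 0) hd'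
  refine ⟨(b.repr.symm.toContinuousLinearEquiv : _ →L[ℂ] H) ∘L M ∘L
    (b.repr.toContinuousLinearEquiv : H →L[ℂ] _), fun i => b.repr.injective ?_⟩
  ext j
  simp [M, b.repr_self, lp.single_apply, Pi.single_apply]
  split_ifs with h
  · rw [h]
  · rfl

theorem inner_diagonal (b : HilbertBasis ι ℂ H) {T : H →L[ℂ] H} {d : ι → ℂ}
    (hT : ∀ i, T (b i) = d i • b i) (i : ι) (x : H) : ⟪b i, T x⟫_ℂ = d i * ⟪b i, x⟫_ℂ := by
  classical
  have h : (innerSL ℂ (b i)) ∘L T = d i • innerSL ℂ (b i) := by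
    refine ContinuousLinearMap.ext_on
      (Submodule.dense_iff_topologicalClosure_eq_top.2 b.dense_span) ?_
    rintro _ ⟨j, rfl⟩
    by_cases hij : i = j
    · subst hij; simp [hT]
    · simp [hT, b.orthonormal.2 hij]
  exact congrArg (fun L : H →L[ℂ] ℂ => L x) h

/-- Parseval, term by term. The alternative `⟪b i, x⟫_ℂ = 0` lets large eigenvalues be ignored on
vectors orthogonal to their eigenvectors, which is how the restriction norms in `mu` are estimated.
-/
theorem norm_diagonal_apply_le (b : HilbertBasis ι ℂ H) {T : H →L[ℂ] H} {d : ι → ℂ}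
    (hT : ∀ i, T (b i) = d i • b i) {C : ℝ} (hC : 0 ≤ C) {x : H}
    (h : ∀ i, ‖d i‖ ≤ C ∨ ⟪b i, x⟫_ℂ = 0) : ‖T x‖ ≤ C * ‖x‖ := by
  refine le_of_sq_le_sq ?_ (by positivity)
  rw [mul_pow]
  refine hasSum_le (fun i => ?_) (b.hasSum_norm_sq (T x)) ((b.hasSum_norm_sq x).mul_left _)
  rw [b.inner_diagonal hT, norm_mul, mul_pow]
  rcases h i with h | h
  · gcongr
  · simp [h]

theorem norm_diagonal_le (b : HilbertBasis ι ℂ H) {T : H →L[ℂ] H} {d : ι → ℂ}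
    (hT : ∀ i, T (b i) = d i • b i) {C : ℝ} (hC : 0 ≤ C) (h : ∀ i, ‖d i‖ ≤ C) : ‖T‖ ≤ C :=
  T.opNorm_le_bound hC fun _ => b.norm_diagonal_apply_le hT hC fun i => Or.inl (h i)

theorem isPositive_diagonal (b : HilbertBasis ι ℂ H) {T : H →L[ℂ] H} {d : ι → ℂ}
    (hT : ∀ i, T (b i) = d i • b i) (hd : ∀ i, 0 ≤ d i) : T.IsPositive := by
  rw [ContinuousLinearMap.isPositive_iff_complex]
  intro x
  have h : 0 ≤ ⟪x, T x⟫_ℂ := by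
    refine hasSum_le (fun i => ?_) hasSum_zero (b.hasSum_inner_mul_inner x (T x))
    rw [b.inner_diagonal hT, mul_left_comm]
    refine mul_nonneg (hd i) ?_
    rw [← inner_conj_symm, RCLike.conj_mul]
    positivity
  have h' : 0 ≤ ⟪T x, x⟫_ℂ := by
    rw [← inner_conj_symm]; simpa using star_nonneg_iff.2 h
  exact ⟨(Complex.eq_re_of_ofReal_le h').symm, (Complex.le_def.1 h').1⟩

/-- Reindexing of a Hilbert basis. -/
theorem exists_reindex [CompleteSpace H] (b : HilbertBasis ι ℂ H) (e : κ ≃ ι) :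
    ∃ b' : HilbertBasis κ ℂ H, ∀ k, b' k = b (e k) := by
  refine ⟨HilbertBasis.mk (b.orthonormal.comp e e.injective) ?_, fun k => ?_⟩
  · rw [e.surjective.range_comp]
    exact b.dense_span.ge
  · rw [HilbertBasis.coe_mk]; rfl

end HilbertBasis

/-! ### Diagonal operators in the weak trace class -/

namespace WeakTrace
open Filter Topology

variable {H : Type*} [NormedAddCommGroup H] [InnerProductSpace ℂ H] [CompleteSpace H]

/-- A diagonal operator with eigenvalues `O(1/m)` is in the weak trace class. -/
theorem mem_weakTraceClass_of_diagonal (b : HilbertBasis ℕ ℂ H) {T : H →L[ℂ] H} {d : ℕ → ℂ}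
    (hT : ∀ m, T (b m) = d m • b m) {C : ℝ} (hd : ∀ m : ℕ, ‖d m‖ ≤ C / (m + 1)) :
    T ∈ weakTraceClass H := by
  have hC : 0 ≤ C := by simpa using (norm_nonneg _).trans (hd 0)
  -- The span of the first `k` basis vectors: on its orthogonal complement only eigenvalues of index
  -- at least `k` remain, all bounded by `C / (k + 1)`.
  let E : ℕ → Submodule ℂ H := fun k => Submodule.span ℂ (Set.range fun i : Fin k => b i)
  have hfin : ∀ k, FiniteDimensional ℂ (E k) := fun k =>
    FiniteDimensional.span_of_finite ℂ (Set.finite_range _)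
  have hrank : ∀ k, Module.finrank ℂ (E k) ≤ k := fun k =>
    (finrank_range_le_card (R := ℂ) fun i : Fin k => b i).trans_eq (Fintype.card_fin k)
  have hE : ∀ k, restrNorm T (E k) ≤ C / (k + 1) := fun k => by
    refine restrNorm_le _ _ (by positivity) fun x hx => ?_
    refine b.norm_diagonal_apply_le hT (by positivity) fun i => ?_
    by_cases hi : i < k
    · exact Or.inr ((Submodule.mem_orthogonal _ _).1 hx _
        (Submodule.subset_span ⟨⟨i, hi⟩, rfl⟩))
    · refine Or.inl ((hd i).trans ?_)
      have : (k : ℝ) ≤ i := by exact_mod_cast not_lt.1 hi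
      gcongr
  refine ⟨?_, C, fun k => (mu_le T (E k) (hrank k)).trans (hE k)⟩
  -- Compactness: `T` is the norm limit of its finite-rank truncations.
  refine isCompactOperator_of_tendsto (l := atTop)
    (F := fun k : ℕ => T ∘L (E k).starProjection) ?_ (Eventually.of_forall fun k => ?_)
  · rw [tendsto_iff_norm_sub_tendsto_zero]
    have hlim : Tendsto (fun k : ℕ => C / ((k : ℝ) + 1)) atTop (𝓝 0) :=
      tendsto_const_div_atTop_nhds_zero_nat C |>.comp (tendsto_add_atTop_nat 1) |>.congr
        fun k => by simp
    refine squeeze_zero (fun _ => norm_nonneg _) (fun k => ?_) hlim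
    refine ContinuousLinearMap.opNorm_le_bound _ (by positivity) fun x => ?_
    have h1 : x - (E k).starProjection x ∈ (E k)ᗮ :=
      (E k).sub_starProjection_mem_orthogonal x
    have h2 : ‖x - (E k).starProjection x‖ ≤ ‖x‖ := by
      rw [← (E k).starProjection_orthogonal_val]
      exact (E k)ᗮ.norm_starProjection_apply_le x
    calc ‖(T ∘L (E k).starProjection - T) x‖ = ‖T (x - (E k).starProjection x)‖ := by
          rw [← norm_neg]; simp
      _ ≤ restrNorm T (E k) * ‖x - (E k).starProjection x‖ := norm_apply_le_restrNorm T _ h1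
      _ ≤ C / (k + 1) * ‖x‖ := by gcongr; exact hE k
  · have : ProperSpace (E k) := FiniteDimensional.proper ℂ (E k)
    have h : IsCompactOperator ((E k).orthogonalProjectionOnto) :=
      isCompactOperator_of_locallyCompactSpace_dom _
    exact h.clm_comp (T ∘L (E k).subtypeL)

theorem exists_diagonal (b : HilbertBasis ℕ ℂ H) {d : ℕ → ℂ} {C : ℝ}
    (hd : ∀ m : ℕ, ‖d m‖ ≤ C / (m + 1)) :
    ∃ T : weakTraceClass H, ∀ m, (T : H →L[ℂ] H) (b m) = d m • b m := by
  have hC : 0 ≤ C := by simpa using (norm_nonneg _).trans (hd 0)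
  obtain ⟨T, hT⟩ := b.exists_diagonal d (C := C) fun m =>
    (hd m).trans (div_le_self hC (by simp))
  exact ⟨⟨T, mem_weakTraceClass_of_diagonal b hT hd⟩, hT⟩

/-! ### Values of normalized positive traces on diagonal operators -/

namespace IsNormalizedPositiveTrace

variable {φ : weakTraceClass H →ₗ[ℂ] ℂ}

theorem map_comp_comm (hφ : IsNormalizedPositiveTrace φ) (A : H →L[ℂ] H) (T : weakTraceClass H) :
    φ ⟨A ∘L (T : H →L[ℂ] H), comp_left_mem A T.2⟩ =
      φ ⟨(T : H →L[ℂ] H) ∘L A, comp_right_mem A T.2⟩ := by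
  rw [← sub_eq_zero, ← map_sub]
  exact hφ.map_commutator A T

/-- Cyclicity: `φ(A T B) = φ(T B A)`, so a one-sided inverse is enough. -/
theorem map_conj (hφ : IsNormalizedPositiveTrace φ) {A B : H →L[ℂ] H} (hBA : B ∘L A = 1)
    {S T : weakTraceClass H} (h : (S : H →L[ℂ] H) = A ∘L (T : H →L[ℂ] H) ∘L B) : φ S = φ T := by
  have h1 := hφ.map_comp_comm A ⟨(T : H →L[ℂ] H) ∘L B, comp_right_mem B T.2⟩
  have h2 : S = ⟨_, comp_left_mem A (comp_right_mem B T.2)⟩ := Subtype.ext h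
  rw [h2, h1]
  congr 1
  ext1
  change ((T : H →L[ℂ] H) ∘L B) ∘L A = T
  rw [ContinuousLinearMap.comp_assoc, hBA]
  rfl

theorem mono (hφ : IsNormalizedPositiveTrace φ) {S T : weakTraceClass H}
    (h : ((T : H →L[ℂ] H) - S).IsPositive) : φ S ≤ φ T := by
  rw [← sub_nonneg, ← map_sub]
  exact hφ.nonneg _ h

/-- Diagonal operators with the same eigenvalues in two bases have the same trace. -/
theorem map_diagonal_eq (hφ : IsNormalizedPositiveTrace φ) {ι : Type*} (b b' : HilbertBasis ι ℂ H)
    {S T : weakTraceClass H} {d : ι → ℂ} (hS : ∀ i, (S : H →L[ℂ] H) (b i) = d i • b i)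
    (hT : ∀ i, (T : H →L[ℂ] H) (b' i) = d i • b' i) : φ S = φ T := by
  classical
  let e : H ≃L[ℂ] H := (b'.repr.trans b.repr.symm).toContinuousLinearEquiv
  have he : ∀ i, e (b' i) = b i := fun i => by
    simp [e, b'.repr_self]
  have he' : ∀ i, e.symm (b i) = b' i := fun i => by rw [← he, e.symm_apply_apply]
  refine hφ.map_conj (A := (e : H →L[ℂ] H)) (B := (e.symm : H →L[ℂ] H)) ?_ ?_
  · ext x; simp
  · refine b.clm_ext fun i => ?_
    simp [hS, he, he', hT]

/-- The normalization fixes the value at one harmonic operator only; unitary invariance carries it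
to every basis. -/
theorem map_harmonic (hφ : IsNormalizedPositiveTrace φ) (b : HilbertBasis ℕ ℂ H)
    {T : weakTraceClass H} (hT : ∀ m : ℕ, (T : H →L[ℂ] H) (b m) = ((m : ℂ) + 1)⁻¹ • b m) :
    φ T = 1 := by
  obtain ⟨T₀, ⟨ξ, hξ⟩, h⟩ := hφ.normalized
  rw [← h]
  exact hφ.map_diagonal_eq b ξ hT hξ

/-- Normalized positive traces vanish on the projections onto the basis vectors. -/
theorem map_single (hφ : IsNormalizedPositiveTrace φ) (b : HilbertBasis ℕ ℂ H) (j : ℕ)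
    {T : weakTraceClass H}
    (hT : ∀ m, (T : H →L[ℂ] H) (b m) = (Pi.single j 1 : ℕ → ℂ) m • b m) : φ T = 0 := by
  have hex : ∀ i : ℕ, ∃ p : weakTraceClass H,
      ∀ m, (p : H →L[ℂ] H) (b m) = (Pi.single i 1 : ℕ → ℂ) m • b m := fun i =>
    exists_diagonal b (C := i + 1) fun m => by
      by_cases h : m = i
      · subst h; simp [div_self (show (m : ℝ) + 1 ≠ 0 by positivity)]
      · rw [Pi.single_eq_of_ne h, norm_zero]; positivity
  choose p hp using hex
  -- Swapping two basis vectors shows that all these rank-one projections have the same trace.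
  have heq : ∀ i, φ (p i) = φ T := fun i => by
    obtain ⟨b', hb'⟩ := b.exists_reindex (Equiv.swap j i)
    refine hφ.map_diagonal_eq b' b (d := Pi.single j 1) (fun k => ?_) hT
    rw [hb', hp]
    congr 1
    simp only [Pi.single_apply, Equiv.swap_apply_eq_iff, Equiv.swap_apply_right]
  obtain ⟨T₀, hT₀⟩ := exists_diagonal b (d := fun m => ((m : ℂ) + 1)⁻¹) (C := 1) fun m => by
    rw [norm_inv, one_div]
    exact_mod_cast le_rfl
  -- The truncations of the harmonic operator lie below it. With `t` the common trace of the
  -- projections, this bounds `t` times every harmonic partial sum by `1`, which forces `t = 0`.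
  have hle : ∀ M : ℕ, φ (∑ m ∈ Finset.range M, ((m : ℂ) + 1)⁻¹ • p m) ≤ φ T₀ := fun M => by
    refine hφ.mono (b.isPositive_diagonal
      (d := fun m => if m < M then 0 else ((m : ℂ) + 1)⁻¹) (fun m => ?_) fun m => ?_)
    · simp only [Submodule.coe_sum, Submodule.coe_smul, _root_.sub_apply,
        sum_apply, _root_.smul_apply, hT₀, hp, smul_smul, ← Finset.sum_smul,
        ← sub_smul]
      congr 1
      simp only [Pi.single_apply, mul_ite, mul_one, mul_zero, Finset.sum_ite_eq,
        Finset.mem_range]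
      split_ifs <;> simp
    · split_ifs
      · exact le_rfl
      · have h : (0 : ℝ) ≤ ((m : ℝ) + 1)⁻¹ := by positivity
        simpa using Complex.zero_le_real.2 h
  have h0 : 0 ≤ φ T := by
    refine hφ.nonneg T (b.isPositive_diagonal hT fun m => ?_)
    by_cases h : m = j
    · subst h; simp
    · simp [h]
  obtain ⟨t, ht, htT⟩ : ∃ t : ℝ, 0 ≤ t ∧ (t : ℂ) = φ T :=
    ⟨(φ T).re, (Complex.le_def.1 h0).1, (Complex.eq_re_of_ofReal_le h0).symm⟩
  rw [← htT, Complex.ofReal_eq_zero]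
  by_contra hne
  have htpos : 0 < t := lt_of_le_of_ne ht (Ne.symm hne)
  obtain ⟨M, hM⟩ :=
    (Real.tendsto_sum_range_one_div_nat_succ_atTop.eventually_gt_atTop (1 / t)).exists
  have h1 := hle M
  simp only [map_sum, map_smul, heq, ← htT, hφ.map_harmonic b hT₀, smul_eq_mul,
    ← Finset.sum_mul] at h1
  have h2 : (∑ m ∈ Finset.range M, 1 / ((m : ℝ) + 1)) * t ≤ 1 := by
    rw [← Complex.real_le_real]
    push_cast
    simpa using h1
  rw [div_lt_iff₀ htpos] at hM
  linarith

/-- Up to finitely many diagonal entries, which `φ` does not see, `T` is dominated by `c` times the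
harmonic operator. -/
theorem map_diagonal_le (hφ : IsNormalizedPositiveTrace φ) (b : HilbertBasis ℕ ℂ H)
    {T : weakTraceClass H} {d : ℕ → ℝ} (hT : ∀ m, (T : H →L[ℂ] H) (b m) = (d m : ℂ) • b m)
    {c : ℝ} (hc : ∀ᶠ m : ℕ in atTop, ((m : ℝ) + 1) * d m ≤ c) : φ T ≤ c := by
  obtain ⟨N, hN⟩ := eventually_atTop.1 hc
  obtain ⟨T₀, hT₀⟩ := exists_diagonal b (d := fun m => ((m : ℂ) + 1)⁻¹) (C := 1) fun m => by
    rw [norm_inv, one_div]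
    exact_mod_cast le_rfl
  have hex : ∀ i : ℕ, ∃ p : weakTraceClass H,
      ∀ m, (p : H →L[ℂ] H) (b m) = (Pi.single i 1 : ℕ → ℂ) m • b m := fun i =>
    exists_diagonal b (C := i + 1) fun m => by
      by_cases h : m = i
      · subst h; simp [div_self (show (m : ℝ) + 1 ≠ 0 by positivity)]
      · rw [Pi.single_eq_of_ne h, norm_zero]; positivity
  choose p hp using hex
  -- The correction `|d m| + |c|` on the first `N` entries makes the difference with `T`
  -- non-negative there for either sign of `c`; its trace is zero.
  have hS : φ ((c : ℂ) • T₀ + ∑ m ∈ Finset.range N, ((|d m| + |c| : ℝ) : ℂ) • p m) = c := by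
    simp [map_sum, hφ.map_harmonic b hT₀, fun i => hφ.map_single b i (hp i)]
  rw [← hS]
  refine hφ.mono (b.isPositive_diagonal (d := fun m => ((c * ((m : ℝ) + 1)⁻¹ +
    (if m < N then |d m| + |c| else 0) - d m : ℝ) : ℂ)) (fun m => ?_) fun m => ?_)
  · simp only [Submodule.coe_add, Submodule.coe_sum, Submodule.coe_smul, _root_.sub_apply,
      _root_.add_apply, sum_apply, _root_.smul_apply, hT₀, hT, hp, smul_smul,
      ← Finset.sum_smul, ← sub_smul, ← add_smul]
    congr 1
    simp only [Pi.single_apply, mul_ite, mul_one, mul_zero, Finset.sum_ite_eq,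
      Finset.mem_range]
    split_ifs <;> simp
  · rw [Complex.zero_le_real]
    have hm : (0 : ℝ) < (m : ℝ) + 1 := by positivity
    split_ifs with h
    · have h1 : |c * ((m : ℝ) + 1)⁻¹| ≤ |c| := by
        rw [abs_mul, abs_of_pos (inv_pos.2 hm)]
        exact mul_le_of_le_one_right (abs_nonneg c) (inv_le_one_of_one_le₀ (by simp))
      linarith [neg_abs_le (c * ((m : ℝ) + 1)⁻¹), le_abs_self (d m)]
    · have h1 := hN m (not_lt.1 h)
      rw [add_zero, ← div_eq_mul_inv, sub_nonneg, le_div_iff₀ hm]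
      linarith

/-- A diagonal operator with eigenvalues `d m ∼ L / m` has trace `L`. -/
theorem map_diagonal (hφ : IsNormalizedPositiveTrace φ) (b : HilbertBasis ℕ ℂ H)
    {T : weakTraceClass H} {d : ℕ → ℝ} (hT : ∀ m, (T : H →L[ℂ] H) (b m) = (d m : ℂ) • b m)
    {L : ℝ} (hL : Tendsto (fun m : ℕ => ((m : ℝ) + 1) * d m) atTop (𝓝 L)) : φ T = L := by
  have h1 : ∀ ε : ℝ, 0 < ε → φ T ≤ ((L + ε : ℝ) : ℂ) := fun ε hε =>
    hφ.map_diagonal_le b hT (hL.eventually_le_const (by linarith))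
  have h2 : ∀ ε : ℝ, 0 < ε → φ (-T) ≤ ((-L + ε : ℝ) : ℂ) := fun ε hε =>
    hφ.map_diagonal_le b (d := fun m => -d m) (fun m => by simp [hT])
      (by simpa using hL.neg.eventually_le_const (show -L < -L + ε by linarith))
  apply Complex.ext
  · refine le_antisymm (le_of_forall_pos_le_add fun ε hε => ?_)
      (le_of_forall_pos_le_add fun ε hε => ?_)
    · exact (Complex.le_def.1 (h1 ε hε)).1
    · have := (Complex.le_def.1 (h2 ε hε)).1
      simp only [map_neg, Complex.neg_re, Complex.ofReal_re] at this ⊢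
      linarith
  -- In the order of `ℂ`, being below a real number forces the imaginary part to vanish.
  · simpa using (Complex.le_def.1 (h1 1 one_pos)).2

end IsNormalizedPositiveTrace

end WeakTrace

/-! ### Sorting eigenvalues and counting lattice points -/

namespace LatticeCount
open Filter Topology

/-- A function on an infinite countable type with finite sublevel sets can be sorted. -/
theorem exists_equiv_nat_monotone {ι : Type*} [Countable ι] [Infinite ι] (ρ : ι → ℝ)
    (hfin : ∀ c, {i | ρ i ≤ c}.Finite) : ∃ σ : ℕ ≃ ι, Monotone (ρ ∘ σ) := by
  classical
  obtain ⟨enc, henc⟩ := Countable.exists_injective_nat ι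
  -- Ties of `ρ` are broken by an arbitrary enumeration, so that the order becomes strict.
  let key : ι → ℝ ×ₗ ℕ := fun i => toLex (ρ i, enc i)
  have hkey : Function.Injective key := fun i j h => henc (congrArg Prod.snd (toLex.injective h))
  have hle : ∀ {i j}, key i ≤ key j → ρ i ≤ ρ j := fun {i j} h => by
    rcases Prod.Lex.le_iff.1 h with h | h
    · exact h.le
    · exact h.1.le
  have hf : ∀ i, {j | key j < key i}.Finite := fun i =>
    (hfin (ρ i)).subset fun j hj => hle (le_of_lt hj)
  -- The rank of `i` is the number of its predecessors. It is injective, and enumerating its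
  -- infinite range in increasing order gives the sorting.
  let r : ι → ℕ := fun i => {j | key j < key i}.ncard
  have hr : ∀ {i j}, key i < key j → r i < r j := fun {i j} h =>
    Set.ncard_lt_ncard ((Set.ssubset_iff_of_subset fun k hk => lt_trans hk h).2
      ⟨i, h, fun hi => lt_irrefl (key i) hi⟩) (hf j)
  have hrinj : Function.Injective r := fun i j h => by
    rcases lt_trichotomy (key i) (key j) with h' | h' | h'
    · exact absurd h (hr h').ne
    · exact hkey h'
    · exact absurd h (hr h').ne'
  have : Infinite (Set.range r) := (Set.infinite_range_of_injective hrinj).to_subtype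
  let σ : ℕ ≃ ι := (Nat.Subtype.orderIsoOfNat (Set.range r)).toEquiv.trans
    (Equiv.ofInjective r hrinj).symm
  have hσ : ∀ m, r (σ m) = Nat.Subtype.orderIsoOfNat (Set.range r) m := fun m =>
    Equiv.apply_ofInjective_symm hrinj _
  refine ⟨σ, fun m l hml => hle (not_lt.1 fun h => ?_)⟩
  have h1 := hr h
  rw [hσ, hσ] at h1
  exact absurd ((Nat.Subtype.orderIsoOfNat (Set.range r)).monotone hml) (not_le.2 h1)

/-- If `#{i | ρ i ≤ c} ∼ V c` then the `m`-th smallest value of `ρ` is `∼ m / V`. -/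
theorem tendsto_succ_div_of_tendsto_card {ι : Type*} (ρ : ι → ℝ)
    (hfin : ∀ c, {i | ρ i ≤ c}.Finite) {V : ℝ}
    (hV : Tendsto (fun c : ℝ => ({i | ρ i ≤ c}.ncard : ℝ) / c) atTop (𝓝 V))
    (σ : ℕ ≃ ι) (hσ : Monotone (ρ ∘ σ)) :
    Tendsto (fun m : ℕ => ((m : ℝ) + 1) / ρ (σ m)) atTop (𝓝 V) := by
  have hinf : Tendsto (fun m => ρ (σ m)) atTop atTop := by
    refine tendsto_atTop.2 fun c => ?_
    have := (hfin c).preimage (σ.injective.injOn)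
    obtain ⟨N, hN⟩ := this.bddAbove
    filter_upwards [eventually_gt_atTop N] with m hm
    by_contra h
    exact absurd (hN (show m ∈ σ ⁻¹' {i | ρ i ≤ c} from (not_le.1 h).le)) (not_le.2 hm)
  have hup : ∀ m : ℕ, (m : ℝ) + 1 ≤ {i | ρ i ≤ ρ (σ m)}.ncard := fun m => by
    have h1 : (σ '' (Finset.range (m + 1) : Set ℕ)) ⊆ {i | ρ i ≤ ρ (σ m)} := by
      rintro _ ⟨j, hj, rfl⟩
      exact hσ (by simpa [Nat.lt_succ_iff] using hj)
    have h2 := Set.ncard_le_ncard h1 (hfin _)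
    rw [Set.ncard_image_of_injective _ σ.injective, Set.ncard_coe_finset, Finset.card_range] at h2
    exact_mod_cast h2
  -- Lowering the threshold by `1` excludes ties with `ρ (σ m)`: only indices below `m` can qualify.
  have hlow : ∀ m : ℕ, ({i | ρ i ≤ ρ (σ m) - 1}.ncard : ℝ) ≤ (m : ℝ) + 1 := fun m => by
    have h1 : {i | ρ i ≤ ρ (σ m) - 1} ⊆ (σ '' (Finset.range (m + 1) : Set ℕ)) := by
      intro i hi
      refine ⟨σ.symm i, ?_, by simp⟩
      by_contra h
      have h3 : m ≤ σ.symm i := by simp at h; omega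
      have h4 := hσ h3
      simp only [Function.comp, Equiv.apply_symm_apply] at h4
      have h5 : ρ i ≤ ρ (σ m) - 1 := hi
      linarith
    have h2 := Set.ncard_le_ncard h1 ((Finset.finite_toSet _).image _)
    rw [Set.ncard_image_of_injective _ σ.injective, Set.ncard_coe_finset, Finset.card_range] at h2
    exact_mod_cast h2
  have hA := hV.comp hinf
  -- The factor `1 - 1/ρ` turns the denominator `ρ - 1` of the counting ratio into `ρ` and tends to
  -- `1`.
  have hB : Tendsto (fun m => ({i | ρ i ≤ ρ (σ m) - 1}.ncard : ℝ) / (ρ (σ m) - 1) *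
      (1 - (ρ (σ m))⁻¹)) atTop (𝓝 V) := by
    have h1 := hV.comp (tendsto_atTop_add_const_right _ (-1) hinf)
    have h2 := (tendsto_inv_atTop_zero.comp hinf).const_sub 1
    simpa [Function.comp_def, sub_eq_add_neg] using h1.mul h2
  refine tendsto_of_tendsto_of_tendsto_of_le_of_le' hB hA ?_ ?_
  · filter_upwards [hinf.eventually_gt_atTop 1] with m hm
    have h0 : 0 < ρ (σ m) := by linarith
    have h1 : ρ (σ m) - 1 ≠ 0 := by linarith
    calc _ = ({i | ρ i ≤ ρ (σ m) - 1}.ncard : ℝ) / ρ (σ m) := by field_simp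
      _ ≤ _ := by gcongr; exact hlow m
  · filter_upwards [hinf.eventually_gt_atTop 1] with m hm
    have h0 : 0 < ρ (σ m) := by linarith
    simp only [Function.comp]
    gcongr
    exact hup m

/-- The Euclidean norm of a lattice point. -/
def latticeNorm {n : ℕ} (k : Fin n → ℤ) : ℝ := √(∑ j, (k j : ℝ) ^ 2)

theorem latticeNorm_nonneg {n : ℕ} (k : Fin n → ℤ) : 0 ≤ latticeNorm k := Real.sqrt_nonneg _

theorem sq_latticeNorm {n : ℕ} (k : Fin n → ℤ) : latticeNorm k ^ 2 = ∑ j, (k j : ℝ) ^ 2 :=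
  Real.sq_sqrt (Finset.sum_nonneg fun _ _ => sq_nonneg _)

theorem abs_le_latticeNorm {n : ℕ} (k : Fin n → ℤ) (j : Fin n) : |(k j : ℝ)| ≤ latticeNorm k :=
  Real.abs_le_sqrt (Finset.single_le_sum (f := fun j => (k j : ℝ) ^ 2)
    (fun _ _ => sq_nonneg _) (Finset.mem_univ j))

theorem latticeNorm_pos {n : ℕ} {k : Fin n → ℤ} (hk : k ≠ 0) : 0 < latticeNorm k := by
  obtain ⟨j, hj⟩ := Function.ne_iff.1 hk
  exact (abs_pos.2 (Int.cast_ne_zero.2 hj)).trans_le (abs_le_latticeNorm k j)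

theorem finite_latticeNorm_le {n : ℕ} (c : ℝ) : {k : Fin n → ℤ | latticeNorm k ≤ c}.Finite := by
  refine (Set.finite_Icc (fun _ => -⌈c⌉) (fun _ => ⌈c⌉)).subset fun k hk => ?_
  have h : ∀ j, |k j| ≤ ⌈c⌉ := fun j => by
    have := ((abs_le_latticeNorm k j).trans hk).trans (Int.le_ceil c)
    exact_mod_cast this
  exact ⟨fun j => (abs_le.1 (h j)).1, fun j => (abs_le.1 (h j)).2⟩

theorem finite_latticeNorm_pow_le {n : ℕ} (hn : n ≠ 0) (c : ℝ) :
    {k : Fin n → ℤ | latticeNorm k ^ n ≤ c}.Finite := by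
  refine (finite_latticeNorm_le (max c 1)).subset fun k hk => ?_
  rcases le_total (latticeNorm k) 1 with h | h
  · exact h.trans (le_max_right _ _)
  · exact ((le_self_pow₀ h hn).trans hk).trans (le_max_left _ _)

theorem covolume_span_basisFun (n : ℕ) :
    ZLattice.covolume (Submodule.span ℤ (Set.range (Pi.basisFun ℝ (Fin n)))) = 1 := by
  rw [ZLattice.covolume_eq_measure_fundamentalDomain _ _
    (ZSpan.isAddFundamentalDomain (Pi.basisFun ℝ (Fin n)) volume),
    ZSpan.fundamentalDomain_pi_basisFun, measureReal_def, Real.volume_pi_Ico]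
  simp

/-- The number of lattice points in a ball is asymptotic to the volume of the ball. -/
theorem tendsto_ncard_latticeNorm_pow_le {n : ℕ} (hn : n ≠ 0) :
    Tendsto (fun c : ℝ => ({k : Fin n → ℤ | latticeNorm k ^ n ≤ c}.ncard : ℝ) / c) atTop
      (𝓝 (sphereArea n / n)) := by
  have : Nonempty (Fin n) := ⟨⟨0, Nat.pos_of_ne_zero hn⟩⟩
  -- The `n`-th power of the norm is homogeneous of degree `n`, so its sublevel sets have volume
  -- linear in the threshold; the unit one is the Euclidean unit ball.
  let F : (Fin n → ℝ) → ℝ := fun x => ‖WithLp.toLp 2 x‖ ^ n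
  have hset : {x ∈ (Set.univ : Set (Fin n → ℝ)) | F x ≤ 1} =
      WithLp.toLp 2 ⁻¹' Metric.closedBall (0 : EuclideanSpace ℝ (Fin n)) 1 := by
    ext x
    simp [F, pow_le_one_iff_of_nonneg (norm_nonneg _) hn]
  have hcont : Continuous fun x : Fin n → ℝ => WithLp.toLp 2 x := PiLp.continuous_toLp 2 _
  have hvol : volume.real {x ∈ (Set.univ : Set (Fin n → ℝ)) | F x ≤ 1} = sphereArea n / n := by
    rw [hset, (PiLp.volume_preserving_toLp (Fin n)).measureReal_preimage
      measurableSet_closedBall.nullMeasurableSet, sphereArea, Measure.toSphere_real_apply_univ,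
      finrank_euclideanSpace_fin, mul_div_cancel_left₀ _ (Nat.cast_ne_zero.2 hn),
      measureReal_def, measureReal_def, Measure.addHaar_closedBall_eq_addHaar_ball]
  have h := ZLattice.covolume.tendsto_card_le_div
    (Submodule.span ℤ (Set.range (Pi.basisFun ℝ (Fin n)))) (X := Set.univ) (F := F)
    (fun _ _ _ _ => Set.mem_univ _) (fun x r hr => ?_) ?_ ?_ ?_
  · rw [hvol, covolume_span_basisFun, div_one] at h
    refine h.congr fun c => ?_
    congr 2
    rw [Nat.card_coe_set_eq, ← Set.ncard_image_of_injective (f := fun (k : Fin n → ℤ) (j : Fin n) =>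
      (k j : ℝ)) _ fun k l hkl => funext fun j => Int.cast_injective (congrFun hkl j)]
    congr 1
    ext x
    simp only [Set.mem_inter_iff, Set.mem_ofPred_eq, Set.mem_univ, true_and, SetLike.mem_coe,
      Module.Basis.mem_span_iff_repr_mem, Pi.basisFun_repr, Set.mem_image]
    constructor
    · rintro ⟨h1, h2⟩
      choose k hk using h2
      refine ⟨k, ?_, funext hk⟩
      simpa [F, EuclideanSpace.norm_eq, latticeNorm, ← hk] using h1
    · rintro ⟨k, h1, rfl⟩
      refine ⟨?_, fun j => ⟨k j, rfl⟩⟩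
      simpa [F, EuclideanSpace.norm_eq, latticeNorm] using h1
  · simp only [F, WithLp.toLp_smul, norm_smul, Real.norm_of_nonneg hr, mul_pow, Fintype.card_fin]
  · rw [hset]
    exact (EuclideanSpace.equiv (Fin n) ℝ).symm.antilipschitz.isBounded_preimage
      Metric.isBounded_closedBall
  · rw [hset]
    exact measurableSet_closedBall.preimage hcont.measurable
  -- The frontier of a convex set is a null set.
  · rw [hset]
    exact ((convex_closedBall (0 : EuclideanSpace ℝ (Fin n)) 1).linear_preimage
      (EuclideanSpace.equiv (Fin n) ℝ).symm.toLinearMap).addHaar_frontier volume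

end LatticeCount

/-! ### Weyl operators and their dense span -/

namespace NCTorus
open UnitAddTorus

variable {n : ℕ}

theorem mulOp_comp (f g : C(UnitAddTorus (Fin n), ℂ)) :
    mulOp f ∘L mulOp g = mulOp (f * g) := by
  ext1 ξ
  apply Lp.ext
  filter_upwards [coeFn_mulOp f (mulOp g ξ), coeFn_mulOp g ξ, coeFn_mulOp (f * g) ξ]
    with x h1 h2 h3
  rw [ContinuousLinearMap.comp_apply, h1, h2, h3, ContinuousMap.mul_apply, mul_assoc]

theorem mulOp_one : mulOp (1 : C(UnitAddTorus (Fin n), ℂ)) = 1 := by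
  ext1 ξ
  apply Lp.ext
  filter_upwards [coeFn_mulOp 1 ξ] with x h1
  rw [h1, ContinuousMap.one_apply, one_mul]
  rfl

theorem norm_mFourier_apply (k : Fin n → ℤ) (x : UnitAddTorus (Fin n)) : ‖mFourier k x‖ = 1 := by
  rw [mFourier, ContinuousMap.coe_mk, norm_prod]
  exact Finset.prod_eq_one fun _ _ => Circle.norm_coe _

theorem mFourier_apply_add (k : Fin n → ℤ) (x t : UnitAddTorus (Fin n)) :
    mFourier k (x + t) = mFourier k x * mFourier k t := by
  simp [mFourier, fourier_apply, AddCircle.toCircle_add, Finset.prod_mul_distrib]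

theorem mFourier_apply_zero (k : Fin n → ℤ) : mFourier k (0 : UnitAddTorus (Fin n)) = 1 := by
  simp [mFourier, fourier_apply]

theorem mFourier_angle (k : Fin n → ℤ) (s : Fin n → ℝ) :
    mFourier k (angle s) = Complex.exp (Complex.I * ∑ j, (k j : ℂ) * s j) := by
  rw [Finset.mul_sum, Complex.exp_sum]
  rw [mFourier, ContinuousMap.coe_mk]
  refine Finset.prod_congr rfl fun j _ => ?_
  rw [angle, fourier_coe_apply]
  congr 1
  push_cast
  field_simp

/-- Multiplicativity of characters. This commutation rule is the source of every phase in the Weyl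
relations. -/
theorem shift_comp_mulOp (t : UnitAddTorus (Fin n)) (k : Fin n → ℤ) :
    shift t ∘L mulOp (mFourier k) = mFourier k t • (mulOp (mFourier k) ∘L shift t) := by
  ext1 ξ
  apply Lp.ext
  have h := (measurePreserving_add_right (haar n) t).quasiMeasurePreserving.ae
    (coeFn_mulOp (mFourier k) ξ)
  filter_upwards [coeFn_shift t (mulOp (mFourier k) ξ), h, coeFn_mulOp (mFourier k) (shift t ξ),
    Lp.coeFn_smul (mFourier k t) (mulOp (mFourier k) (shift t ξ)), coeFn_shift t ξ]
    with x e1 e2 e3 e4 e5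
  simp only [ContinuousLinearMap.comp_apply, _root_.smul_apply]
  rw [e1, e2, e4, Pi.smul_apply, e3, e5, mFourier_apply_add, smul_eq_mul]
  ring

variable (θ : Matrix (Fin n) (Fin n) ℝ)

/-- The translation that occurs in the Weyl operator of frequency `k`. -/
def weylShift (k : Fin n → ℤ) : UnitAddTorus (Fin n) :=
  ∑ j, k j • (fun l => ((θ l j / 2 : ℝ) : UnitAddCircle))

theorem weylShift_add (k l : Fin n → ℤ) :
    weylShift θ (k + l) = weylShift θ k + weylShift θ l := by
  simp only [weylShift, Pi.add_apply, add_smul, Finset.sum_add_distrib]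

theorem weylShift_zero : weylShift θ 0 = 0 := by
  simp [weylShift]

theorem weylShift_single (j : Fin n) :
    weylShift θ (Pi.single j 1) = fun l => ((θ l j / 2 : ℝ) : UnitAddCircle) := by
  rw [weylShift, Finset.sum_eq_single j (fun i _ hi => by rw [Pi.single_eq_of_ne hi, zero_smul])
    (by simp), Pi.single_eq_same, one_smul]

/-- The Weyl operators: the monomials in the `U_j`, up to a phase. -/
def weylOp (k : Fin n → ℤ) : Op n := mulOp (mFourier k) ∘L shift (weylShift θ k)

theorem weylOp_mul (k l : Fin n → ℤ) :
    weylOp θ k * weylOp θ l = mFourier l (weylShift θ k) • weylOp θ (k + l) := by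
  change (mulOp (mFourier k) ∘L shift (weylShift θ k)) ∘L
    (mulOp (mFourier l) ∘L shift (weylShift θ l)) = _
  rw [ContinuousLinearMap.comp_assoc, ← ContinuousLinearMap.comp_assoc (shift _),
    shift_comp_mulOp, ContinuousLinearMap.smul_comp, ContinuousLinearMap.comp_smul,
    ContinuousLinearMap.comp_assoc, ← shift_add, ← ContinuousLinearMap.comp_assoc, mulOp_comp,
    weylOp, weylShift_add]
  congr 3
  ext x
  exact mFourier_add.symm

theorem weylOp_zero : weylOp θ 0 = 1 := by
  rw [weylOp, weylShift_zero, shift_zero, mFourier_zero, mulOp_one]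
  rfl

theorem weylOp_single (j : Fin n) : weylOp θ (Pi.single j 1) = U θ j := by
  rw [weylOp, weylShift_single, U]

theorem norm_weylOp_apply (k : Fin n → ℤ) (ξ : L2 n) : ‖weylOp θ k ξ‖ = ‖ξ‖ := by
  have h1 : ‖shift (weylShift θ k) ξ‖ = ‖ξ‖ :=
    (Lp.compMeasurePreservingₗᵢ ℂ (fun x => x + weylShift θ k)
      (measurePreserving_add_right (haar n) (weylShift θ k))).norm_map ξ
  rw [← h1, weylOp, ContinuousLinearMap.comp_apply, Lp.norm_def, Lp.norm_def]
  congr 1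
  refine eLpNorm_congr_norm_ae ?_
  filter_upwards [coeFn_mulOp (mFourier k) (shift (weylShift θ k) ξ)] with x hx
  rw [hx, norm_mul, norm_mFourier_apply, one_mul]

theorem star_weylOp (k : Fin n → ℤ) :
    star (weylOp θ k) = mFourier k (weylShift θ k) • weylOp θ (-k) := by
  have h1 : star (weylOp θ k) * weylOp θ k = 1 := by
    rw [ContinuousLinearMap.star_eq_adjoint]
    exact (ContinuousLinearMap.norm_map_iff_adjoint_comp_self _).1 (norm_weylOp_apply θ k)
  refine left_inv_eq_right_inv h1 ?_
  rw [mul_smul_comm, weylOp_mul, add_neg_cancel, weylOp_zero, smul_smul, ← ContinuousMap.mul_apply]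
  have : mFourier k (weylShift θ k) * mFourier (-k) (weylShift θ k) = 1 := by
    rw [← mFourier_add, add_neg_cancel, mFourier_zero, ContinuousMap.one_apply]
  rw [ContinuousMap.mul_apply, this, one_smul]

theorem smul_mem_of_norm_one {A : StarSubalgebra ℂ (Op n)} {c : ℂ} (hc : ‖c‖ = 1) {T : Op n}
    (h : c • T ∈ A) : T ∈ A := by
  have hc0 : c ≠ 0 := norm_ne_zero_iff.1 (by rw [hc]; exact one_ne_zero)
  simpa [smul_smul, inv_mul_cancel₀ hc0] using A.smul_mem h c⁻¹

/-- The admissible frequencies form a subgroup of `ℤⁿ`, since products and adjoints of Weyl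
operators are Weyl operators up to invertible phases; it contains the standard generators. -/
theorem weylOp_mem_adjoin (k : Fin n → ℤ) :
    weylOp θ k ∈ StarAlgebra.adjoin ℂ (Set.range (U θ)) := by
  let G : AddSubgroup (Fin n → ℤ) :=
    { carrier := {k | weylOp θ k ∈ StarAlgebra.adjoin ℂ (Set.range (U θ))}
      zero_mem' := by
        rw [Set.mem_ofPred_eq, weylOp_zero]
        exact one_mem _
      add_mem' := fun {k l} hk hl =>
        smul_mem_of_norm_one (norm_mFourier_apply l (weylShift θ k))
          (weylOp_mul θ k l ▸ mul_mem
            (show weylOp θ k ∈ StarAlgebra.adjoin ℂ (Set.range (U θ)) from hk)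
            (show weylOp θ l ∈ StarAlgebra.adjoin ℂ (Set.range (U θ)) from hl))
      neg_mem' := fun {k} hk =>
        smul_mem_of_norm_one (norm_mFourier_apply k (weylShift θ k))
          (star_weylOp θ k ▸ star_mem
            (show weylOp θ k ∈ StarAlgebra.adjoin ℂ (Set.range (U θ)) from hk)) }
  have hG : ∀ j, Pi.single j 1 ∈ G := fun j => by
    change weylOp θ (Pi.single j 1) ∈ StarAlgebra.adjoin ℂ (Set.range (U θ))
    rw [weylOp_single]
    exact StarAlgebra.subset_adjoin ℂ _ ⟨j, rfl⟩
  have h : k = ∑ j, k j • Pi.single j (1 : ℤ) := by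
    simp only [← Pi.single_smul, smul_eq_mul, mul_one]
    exact (Finset.univ_sum_single k).symm
  change k ∈ G
  rw [h]
  exact sum_mem fun j _ => zsmul_mem (hG j) _

/-- By the same relations the linear span is already closed under products and adjoints. -/
theorem adjoin_le_span_weylOp {T : Op n} (hT : T ∈ StarAlgebra.adjoin ℂ (Set.range (U θ))) :
    T ∈ Submodule.span ℂ (Set.range (weylOp θ)) := by
  have hmem : ∀ k, weylOp θ k ∈ Submodule.span ℂ (Set.range (weylOp θ)) := fun k =>
    Submodule.subset_span ⟨k, rfl⟩
  induction hT using StarAlgebra.adjoin_induction with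
  | mem x hx =>
    obtain ⟨j, rfl⟩ := hx
    rw [← weylOp_single]
    exact hmem _
  | algebraMap r =>
    rw [Algebra.algebraMap_eq_smul_one, ← weylOp_zero θ]
    exact Submodule.smul_mem _ _ (hmem 0)
  | add x y _ _ hx hy => exact add_mem hx hy
  | mul x y _ _ hx hy =>
    refine (?_ : Submodule.span ℂ (Set.range (weylOp θ)) * Submodule.span ℂ (Set.range (weylOp θ))
      ≤ Submodule.span ℂ (Set.range (weylOp θ))) (Submodule.mul_mem_mul hx hy)
    rw [Submodule.span_mul_span, Submodule.span_le]
    rintro _ ⟨_, ⟨k, rfl⟩, _, ⟨l, rfl⟩, rfl⟩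
    change weylOp θ k * weylOp θ l ∈ _
    rw [weylOp_mul]
    exact Submodule.smul_mem _ _ (hmem _)
  | star x hx' hx =>
    clear hx'
    induction hx using Submodule.span_induction with
    | mem x hx =>
      obtain ⟨k, rfl⟩ := hx
      rw [star_weylOp]
      exact Submodule.smul_mem _ _ (hmem _)
    | zero => simp
    | add x y _ _ hx hy => rw [star_add]; exact add_mem hx hy
    | smul c x _ hx => rw [star_smul]; exact Submodule.smul_mem _ _ hx

/-- The Weyl operators as elements of `A_θ`. -/
def weyl (k : Fin n → ℤ) : NCTorus θ :=
  (⟨weylOp θ k, StarSubalgebra.le_topologicalClosure _ (weylOp_mem_adjoin θ k)⟩ : algebraOf θ)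

theorem toOp_weyl (k : Fin n → ℤ) : toOp θ (weyl θ k) = weylOp θ k := rfl

theorem toOp_injective : Function.Injective (toOp θ) := Subtype.val_injective

theorem weyl_mul (k l : Fin n → ℤ) :
    weyl θ k * weyl θ l = mFourier l (weylShift θ k) • weyl θ (k + l) := by
  apply toOp_injective
  rw [map_mul, map_smul]
  exact weylOp_mul θ k l

theorem weyl_zero : weyl θ 0 = 1 := toOp_injective θ (weylOp_zero θ)

theorem dense_span_weyl :
    Dense (Submodule.span ℂ (Set.range (weyl θ)) : Set (NCTorus θ)) := by
  refine Subtype.dense_iff.2 fun T hT => ?_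
  refine closure_mono ?_ (show T ∈ closure
    (StarAlgebra.adjoin ℂ (Set.range (U θ)) : Set (Op n)) from hT)
  intro S hS
  have h := adjoin_le_span_weylOp θ hS
  have hr : Set.range (weylOp θ) = (toOp θ).toLinearMap '' Set.range (weyl θ) := by
    rw [← Set.range_comp]; rfl
  rw [hr, ← Submodule.map_span] at h
  exact h

theorem clm_ext_weyl {E : Type*} [NormedAddCommGroup E] [NormedSpace ℂ E]
    {S T : NCTorus θ →L[ℂ] E} (h : ∀ k, S (weyl θ k) = T (weyl θ k)) : S = T :=
  ContinuousLinearMap.ext_on (dense_span_weyl θ) (by rintro _ ⟨k, rfl⟩; exact h k)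

end NCTorus

/-! ### The Weyl basis of the GNS space and the action of the Laplacian on it -/

namespace NCTorus
open UnitAddTorus

variable {n : ℕ} (θ : Matrix (Fin n) (Fin n) ℝ)

/-- Makes `a ↦ a 1` an isometric model of the GNS space inside `L²(𝕋ⁿ)`, where orthonormality can be
read off from Fourier theory. -/
theorem inner_toHilb (a b : NCTorus θ) :
    ⟪toHilb θ a, toHilb θ b⟫_ℂ = ⟪toOp θ a (one2 n), toOp θ b (one2 n)⟫_ℂ := by
  have h1 : ⟪toHilb θ a, toHilb θ b⟫_ℂ = ⟪(tau θ).toPreGNS a, (tau θ).toPreGNS b⟫_ℂ :=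
    UniformSpace.Completion.inner_coe _ _
  rw [h1, PositiveLinearMap.preGNS_inner_def, PositiveLinearMap.ofPreGNS_toPreGNS,
    PositiveLinearMap.ofPreGNS_toPreGNS]
  change ⟪one2 n, toOp θ (star a * b) (one2 n)⟫_ℂ = _
  rw [map_mul, map_star, mul_apply_eq_comp, ContinuousLinearMap.star_eq_adjoint,
    ContinuousLinearMap.adjoint_inner_right]

theorem leftMul_toHilb (a b : NCTorus θ) : leftMul θ a (toHilb θ b) = toHilb θ (a * b) := by
  exact PositiveLinearMap.gnsNonUnitalStarAlgHom_apply_coe (tau θ)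

/-- The canonical map `A_θ → ℋ_θ` as a bounded operator. -/
def toHilbL : NCTorus θ →L[ℂ] Hilb θ :=
  (toHilb θ).mkContinuous ‖toHilb θ 1‖ fun a => by
    -- The image of `a` is `a` acting on the cyclic vector, and *-homomorphisms of C*-algebras are
    -- contractive.
    have h := (leftMul θ a).le_opNorm (toHilb θ 1)
    rw [leftMul_toHilb, mul_one] at h
    refine h.trans ?_
    rw [mul_comm]
    gcongr
    exact NonUnitalStarAlgHom.norm_apply_le (leftMul θ) a

theorem toHilbL_apply (a : NCTorus θ) : toHilbL θ a = toHilb θ a := rfl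

theorem denseRange_toHilb : DenseRange (toHilb θ) :=
  UniformSpace.Completion.denseRange_coe (α := (tau θ).PreGNS)

theorem weylOp_one2 (k : Fin n → ℤ) :
    weylOp θ k (one2 n) = ContinuousMap.toLp 2 (haar n) ℂ (mFourier k) := by
  have h1 : shift (weylShift θ k) (one2 n) = one2 n := by
    apply Lp.ext
    have h := ContinuousMap.coeFn_toLp (p := 2) (𝕜 := ℂ) (haar n)
      (1 : C(UnitAddTorus (Fin n), ℂ))
    have h' := (measurePreserving_add_right (haar n)
      (weylShift θ k)).quasiMeasurePreserving.ae h
    filter_upwards [coeFn_shift (weylShift θ k) (one2 n), h, h'] with x e1 e2 e3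
    rw [e1, one2, e2, e3]
    rfl
  rw [weylOp, ContinuousLinearMap.comp_apply, h1]
  apply Lp.ext
  filter_upwards [coeFn_mulOp (mFourier k) (one2 n),
    ContinuousMap.coeFn_toLp (p := 2) (𝕜 := ℂ) (haar n) (1 : C(UnitAddTorus (Fin n), ℂ)),
    ContinuousMap.coeFn_toLp (p := 2) (𝕜 := ℂ) (haar n) (mFourier k)] with x e1 e2 e3
  rw [e1, one2, e2, e3, ContinuousMap.one_apply, mul_one]

theorem orthonormal_toHilb_weyl : Orthonormal ℂ fun k => toHilb θ (weyl θ k) := by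
  have h := orthonormal_mFourier (d := Fin n)
  rw [orthonormal_iff_ite] at h ⊢
  intro k l
  rw [inner_toHilb, toOp_weyl, toOp_weyl, weylOp_one2, weylOp_one2]
  exact h k l

/-- The orthonormal basis of `ℋ_θ` that is given by the Weyl operators. -/
def weylBasis : HilbertBasis (Fin n → ℤ) ℂ (Hilb θ) :=
  HilbertBasis.mk (orthonormal_toHilb_weyl θ) <| by
    rw [top_le_iff, ← Submodule.dense_iff_topologicalClosure_eq_top]
    have h := (denseRange_toHilb θ).dense_image (toHilbL θ).continuous (dense_span_weyl θ)
    refine h.mono ?_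
    rw [show (Set.range fun k => toHilb θ (weyl θ k)) =
      (toHilbL θ : NCTorus θ →ₗ[ℂ] Hilb θ) '' Set.range (weyl θ) by rw [← Set.range_comp]; rfl,
      ← Submodule.map_span]
    exact subset_rfl

theorem weylBasis_apply (k : Fin n → ℤ) : weylBasis θ k = toHilb θ (weyl θ k) := by
  rw [weylBasis, HilbertBasis.coe_mk]

theorem leftMul_weyl_weylBasis (k l : Fin n → ℤ) :
    leftMul θ (weyl θ k) (weylBasis θ l) =
      mFourier l (weylShift θ k) • weylBasis θ (k + l) := by
  rw [weylBasis_apply, weylBasis_apply, leftMul_toHilb, weyl_mul, map_smul]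

theorem tau_weyl (k : Fin n → ℤ) : tau θ (weyl θ k) = if k = 0 then 1 else 0 := by
  have h1 : tau θ (weyl θ k) = ⟪weylBasis θ 0, weylBasis θ k⟫_ℂ := by
    rw [weylBasis_apply, weylBasis_apply, inner_toHilb, weyl_zero, map_one]
    rfl
  rw [h1, orthonormal_iff_ite.1 (weylBasis θ).orthonormal 0 k]
  simp only [eq_comm]

theorem alpha_weyl (s : Fin n → ℝ) (k : Fin n → ℤ) :
    alpha θ s (weyl θ k) = mFourier k (angle s) • weyl θ k := by
  apply toOp_injective
  rw [toOp_alpha, map_smul, toOp_weyl, conj_apply, weylOp]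
  change (shift (angle s) ∘L (mulOp (mFourier k) ∘L shift (weylShift θ k))) ∘L shift (-angle s) = _
  rw [← ContinuousLinearMap.comp_assoc, shift_comp_mulOp, ContinuousLinearMap.smul_comp,
    ContinuousLinearMap.smul_comp, ContinuousLinearMap.comp_assoc, ContinuousLinearMap.comp_assoc,
    ← shift_add, ← shift_add, add_neg_cancel_comm_assoc]

theorem weyl_mem_smooth (k : Fin n → ℤ) : weyl θ k ∈ smooth θ := by
  change ContDiff ℝ ∞ fun s : Fin n → ℝ => alpha θ s (weyl θ k)
  simp only [alpha_weyl, mFourier_angle]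
  refine ContDiff.smul (ContDiff.cexp (contDiff_const.mul (ContDiff.sum fun j _ =>
    contDiff_const.mul (Complex.ofRealCLM.contDiff.comp (contDiff_apply ℝ ℝ j))))) contDiff_const

/-- The Fourier coefficient of frequency `k` transforms by a character under translations. -/
theorem inner_weylBasis_alpha (s : Fin n → ℝ) (k : Fin n → ℤ) (u : NCTorus θ) :
    ⟪weylBasis θ k, toHilb θ (alpha θ s u)⟫_ℂ =
      mFourier k (angle s) * ⟪weylBasis θ k, toHilb θ u⟫_ℂ := by
  have h : (innerSL ℂ (weylBasis θ k)) ∘L toHilbL θ ∘L alpha θ s =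
      mFourier k (angle s) • ((innerSL ℂ (weylBasis θ k)) ∘L toHilbL θ) := by
    refine clm_ext_weyl θ fun l => ?_
    simp only [ContinuousLinearMap.comp_apply, alpha_weyl, map_smul, toHilbL_apply,
      ← weylBasis_apply, _root_.smul_apply, innerSL_apply_apply,
      orthonormal_iff_ite.1 (weylBasis θ).orthonormal, smul_eq_mul]
    split_ifs with hkl
    · rw [hkl]
    · simp
  exact congrArg (fun L : NCTorus θ →L[ℂ] ℂ => L u) h

/-- Differentiation of the equivariance in `h` at `s = 0`. Taking `L` to be the identity at `u =
W_k` gives eigenvectors; taking a Fourier coefficient gives the formula for all smooth `u`, which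
rules out further eigenvectors. -/
theorem map_delta {E : Type*} [NormedAddCommGroup E] [NormedSpace ℂ E] (L : NCTorus θ →L[ℂ] E)
    (k : Fin n → ℤ) (u : smooth θ)
    (h : ∀ s, L (alpha θ s u) = mFourier k (angle s) • L u) (j : Fin n) :
    L (delta θ j u) = (k j : ℂ) • L u := by
  have h1 : HasFDerivAt (fun s : Fin n → ℝ => L (alpha θ s u))
      ((L.restrictScalars ℝ).comp (fderiv ℝ (fun s : Fin n → ℝ => alpha θ s u) 0)) 0 :=
    (L.restrictScalars ℝ).hasFDerivAt.comp 0 (differentiable_alpha θ u.2 0).hasFDerivAt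
  have h2 : HasDerivAt (fun t : ℝ => L (alpha θ (t • Pi.single j 1) u))
      (L (partialAlpha θ j u 0)) 0 := by
    have := h1.hasLineDerivAt (Pi.single j (1 : ℝ))
    simpa [HasLineDerivAt, partialAlpha] using this
  have h3 : HasDerivAt (fun t : ℝ => L (alpha θ (t • Pi.single j 1) u))
      ((Complex.I * k j) • L u) 0 := by
    have hfun : (fun t : ℝ => L (alpha θ (t • Pi.single j 1) u)) =
        fun t : ℝ => Complex.exp (Complex.I * k j * t) • L u := by
      funext t
      rw [h, mFourier_angle]
      congr 2
      rw [Finset.sum_eq_single j (fun i _ hi => by simp [hi]) (by simp)]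
      simp [mul_assoc]
    rw [hfun]
    have h4 : HasDerivAt (fun t : ℝ => Complex.exp (Complex.I * k j * t)) (Complex.I * k j) 0 := by
      have := ((Complex.ofRealCLM.hasDerivAt (x := (0 : ℝ))).const_mul (Complex.I * k j)).cexp
      simpa using this
    exact h4.smul_const (L u)
  change L ((1 / Complex.I) • partialAlpha θ j u 0) = _
  rw [map_smul, h2.unique h3, smul_smul]
  congr 1
  field_simp

theorem delta_weyl (j : Fin n) (k : Fin n → ℤ) :
    delta θ j ⟨weyl θ k, weyl_mem_smooth θ k⟩ = (k j : ℂ) • ⟨weyl θ k, weyl_mem_smooth θ k⟩ :=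
  Subtype.ext (map_delta θ (ContinuousLinearMap.id ℂ _) k ⟨weyl θ k, weyl_mem_smooth θ k⟩
    (fun s => alpha_weyl θ s k) j)

theorem laplacian_weyl (k : Fin n → ℤ) :
    laplacian θ ⟨weyl θ k, weyl_mem_smooth θ k⟩ =
      ((LatticeCount.latticeNorm k ^ 2 : ℝ) : ℂ) • ⟨weyl θ k, weyl_mem_smooth θ k⟩ := by
  simp only [laplacian, LinearMap.sum_apply, Module.End.mul_apply, delta_weyl, map_smul, smul_smul,
    ← Finset.sum_smul, LatticeCount.sq_latticeNorm]
  push_cast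
  simp only [sq]

/-- Plays the role of the symmetry of `Δ`: an eigenvector for `μ` has no component along `W_k`
unless `|k|² = μ`. -/
theorem inner_weylBasis_laplacian (k : Fin n → ℤ) (u : smooth θ) :
    ⟪weylBasis θ k, toHilb θ (laplacian θ u)⟫_ℂ =
      ((LatticeCount.latticeNorm k ^ 2 : ℝ) : ℂ) * ⟪weylBasis θ k, toHilb θ u⟫_ℂ := by
  have h : ∀ j (v : smooth θ), ⟪weylBasis θ k, toHilb θ (delta θ j v)⟫_ℂ =
      k j * ⟪weylBasis θ k, toHilb θ v⟫_ℂ := fun j v =>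
    map_delta θ ((innerSL ℂ (weylBasis θ k)) ∘L toHilbL θ) k v
      (fun s => inner_weylBasis_alpha θ s k v) j
  simp only [laplacian, LinearMap.sum_apply, Module.End.mul_apply, Submodule.coe_sum, map_sum,
    inner_sum, h, LatticeCount.sq_latticeNorm]
  push_cast
  rw [Finset.sum_mul]
  exact Finset.sum_congr rfl fun j _ => by ring

end NCTorus

/-! ### Spectral description of the negative powers of the Laplacian -/

namespace NCTorus
open UnitAddTorus LatticeCount Filter Topology

variable {n : ℕ} (θ : Matrix (Fin n) (Fin n) ℝ)

theorem starProjection_eigenspace_weylBasis (μ : ℝ) (k : Fin n → ℤ) :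
    ((((laplacian θ).eigenspace (μ : ℂ)).map
      (toHilb θ ∘ₗ (smooth θ).subtype)).topologicalClosure).starProjection (weylBasis θ k) =
      (if latticeNorm k ^ 2 = μ then (1 : ℂ) else 0) • weylBasis θ k := by
  split_ifs with h
  · rw [one_smul, Submodule.starProjection_eq_self_iff]
    refine Submodule.le_topologicalClosure _ ⟨⟨weyl θ k, weyl_mem_smooth θ k⟩, ?_, ?_⟩
    · rw [SetLike.mem_coe, Module.End.mem_eigenspace_iff, laplacian_weyl, h]
    · rw [weylBasis_apply]; rfl
  · rw [zero_smul]
    refine (Submodule.starProjection_apply_eq_zero_iff _).2 ?_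
    rw [Submodule.orthogonal_closure, Submodule.mem_orthogonal']
    rintro _ ⟨u, hu, rfl⟩
    have h1 := inner_weylBasis_laplacian θ k u
    rw [Module.End.mem_eigenspace_iff.1 hu, Submodule.coe_smul, map_smul, inner_smul_right,
      mul_eq_mul_right_iff] at h1
    exact h1.resolve_left fun h2 => h (Complex.ofReal_injective h2).symm

/-- The eigenvalues of `Δ^{-s}`. -/
def negPowerEigenvalue (s : ℝ) (k : Fin n → ℤ) : ℝ :=
  if k = 0 then 0 else (latticeNorm k ^ 2) ^ (-s)

theorem negPowerEigenvalue_nonneg (s : ℝ) (k : Fin n → ℤ) : 0 ≤ negPowerEigenvalue s k := by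
  unfold negPowerEigenvalue
  split_ifs
  · exact le_rfl
  · positivity

theorem one_le_sq_latticeNorm {k : Fin n → ℤ} (hk : k ≠ 0) : 1 ≤ latticeNorm k ^ 2 := by
  obtain ⟨j, hj⟩ := Function.ne_iff.1 hk
  have h : (1 : ℝ) ≤ |(k j : ℝ)| := by exact_mod_cast Int.one_le_abs hj
  exact one_le_pow₀ (h.trans (abs_le_latticeNorm k j))

theorem negPowerEigenvalue_le_one {s : ℝ} (hs : 0 ≤ s) (k : Fin n → ℤ) :
    negPowerEigenvalue s k ≤ 1 := by
  unfold negPowerEigenvalue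
  split_ifs with hk
  · exact zero_le_one
  · exact Real.rpow_le_one_of_one_le_of_nonpos (one_le_sq_latticeNorm hk) (by linarith)

/-- The operator `Δ^{-s}` is diagonal in the basis of Weyl operators. -/
theorem laplacianNegPower_weylBasis {s : ℝ} (hs : 0 < s) (k : Fin n → ℤ) :
    laplacianNegPower θ s (weylBasis θ k) = (negPowerEigenvalue s k : ℂ) • weylBasis θ k := by
  classical
  obtain ⟨P, hP⟩ := (weylBasis θ).exists_diagonal (fun k => (negPowerEigenvalue s k : ℂ)) (C := 1)
    fun k => by
      rw [Complex.norm_real, Real.norm_of_nonneg (negPowerEigenvalue_nonneg s k)]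
      exact negPowerEigenvalue_le_one hs.le k
  suffices h : laplacianNegPower θ s = P by rw [h, hP]
  refine HasSum.tsum_eq (Metric.tendsto_nhds.2 fun ε hε => ?_)
  -- Beyond `R` the eigenvalues `μ^{-s}` are below `ε / 2`, and only finitely many eigenvalues of
  -- `Δ` lie up to `R`. A partial sum containing these differs from `P` by a diagonal operator with
  -- entries at most `ε / 2`.
  obtain ⟨R, hR⟩ := eventually_atTop.1 ((tendsto_rpow_neg_atTop hs).eventually_lt_const
    (half_pos hε))
  have hfin : {μ : {μ : ℝ // 0 < μ} | ∃ k : Fin n → ℤ, latticeNorm k ≤ √R ∧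
      latticeNorm k ^ 2 = μ}.Finite := by
    refine (((finite_latticeNorm_le (n := n) √R).image fun k => latticeNorm k ^ 2).preimage
      Subtype.val_injective.injOn).subset ?_
    rintro μ ⟨k, h1, h2⟩
    exact ⟨k, h1, h2⟩
  filter_upwards [eventually_ge_atTop hfin.toFinset] with S hS
  rw [dist_eq_norm]
  refine lt_of_le_of_lt ?_ (half_lt_self hε)
  refine (weylBasis θ).norm_diagonal_le (d := fun k => ((∑ μ ∈ S,
    if latticeNorm k ^ 2 = μ then (μ : ℝ) ^ (-s) else 0) - negPowerEigenvalue s k : ℝ))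
    (fun k => ?_) (half_pos hε).le fun k => ?_
  · simp only [_root_.sub_apply, sum_apply, _root_.smul_apply,
      starProjection_eigenspace_weylBasis, smul_smul, ← Finset.sum_smul, hP, ← sub_smul]
    congr 1
    simp only [mul_ite, mul_one, mul_zero, Complex.ofReal_sub, Complex.ofReal_sum]
    congr 1
    refine Finset.sum_congr rfl fun μ _ => ?_
    split_ifs <;> simp
  · rw [Complex.norm_real]
    by_cases hk : k = 0
    · rw [Finset.sum_eq_zero, negPowerEigenvalue, if_pos hk]
      · simpa using (half_pos hε).le
      · intro μ _
        rw [if_neg]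
        subst hk
        simpa [sq_latticeNorm] using μ.2.ne
    · have hpos : 0 < latticeNorm k ^ 2 := pow_pos (latticeNorm_pos hk) 2
      by_cases hkS : (⟨latticeNorm k ^ 2, hpos⟩ : {μ : ℝ // 0 < μ}) ∈ S
      · rw [Finset.sum_eq_single_of_mem _ hkS
          fun μ _ hμ => if_neg fun h => hμ (Subtype.ext h.symm), if_pos rfl, negPowerEigenvalue,
          if_neg hk, sub_self, norm_zero]
        exact (half_pos hε).le
      · rw [Finset.sum_eq_zero fun μ hμ => if_neg fun h => hkS ?_, zero_sub, norm_neg,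
          negPowerEigenvalue, if_neg hk, Real.norm_of_nonneg (by positivity)]
        · refine (hR _ ?_).le
          by_contra hlt
          refine hkS (hS (hfin.mem_toFinset.2 ⟨k, ?_, rfl⟩))
          exact Real.le_sqrt_of_sq_le (not_le.1 hlt).le
        · rwa [show (⟨latticeNorm k ^ 2, hpos⟩ : {μ : ℝ // 0 < μ}) = μ from Subtype.ext h]

theorem isPositive_laplacianNegPower {s : ℝ} (hs : 0 < s) : (laplacianNegPower θ s).IsPositive :=
  (weylBasis θ).isPositive_diagonal (laplacianNegPower_weylBasis θ hs) fun k =>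
    Complex.zero_le_real.2 (negPowerEigenvalue_nonneg s k)

/-- The eigenvalues of `Δ^{-n/2}`, in decreasing order, are asymptotic to `|𝕊^{n-1}| / (n m)`. -/
theorem exists_sorted_eigenvalues (hn : n ≠ 0) : ∃ σ : ℕ ≃ (Fin n → ℤ),
    Tendsto (fun m : ℕ => ((m : ℝ) + 1) * negPowerEigenvalue ((n : ℝ) / 2) (σ m)) atTop
      (𝓝 (sphereArea n / n)) := by
  have : Nonempty (Fin n) := ⟨⟨0, Nat.pos_of_ne_zero hn⟩⟩
  obtain ⟨σ, hσ⟩ := exists_equiv_nat_monotone (fun k : Fin n → ℤ => latticeNorm k ^ n)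
    (finite_latticeNorm_pow_le hn)
  refine ⟨σ, (tendsto_succ_div_of_tendsto_card _ (finite_latticeNorm_pow_le hn)
    (tendsto_ncard_latticeNorm_pow_le hn) σ hσ).congr' ?_⟩
  -- Past the position of the frequency `0`, where the eigenvalue is zero by convention, the power
  -- formula holds.
  filter_upwards [eventually_gt_atTop (σ.symm 0)] with m hm
  have h0 : σ m ≠ 0 := fun h => hm.ne' (by rw [← h, σ.symm_apply_apply])
  rw [negPowerEigenvalue, if_neg h0, div_eq_mul_inv, Real.rpow_neg (by positivity),
    ← Real.rpow_natCast (latticeNorm (σ m)) 2, ← Real.rpow_mul (latticeNorm_nonneg _),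
    ← Real.rpow_natCast (latticeNorm (σ m)) n]
  congr 3
  push_cast
  ring

theorem exists_sorted_basis (hn : n ≠ 0) : ∃ (b : HilbertBasis ℕ ℂ (Hilb θ)) (d : ℕ → ℝ),
    (∀ m, laplacianNegPower θ ((n : ℝ) / 2) (b m) = (d m : ℂ) • b m) ∧ (∀ m, 0 ≤ d m) ∧
      Tendsto (fun m : ℕ => ((m : ℝ) + 1) * d m) atTop (𝓝 (sphereArea n / n)) := by
  obtain ⟨σ, hσ⟩ := exists_sorted_eigenvalues hn
  obtain ⟨b, hb⟩ := (weylBasis θ).exists_reindex σ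
  refine ⟨b, _, fun m => ?_, fun m => negPowerEigenvalue_nonneg _ _, hσ⟩
  rw [hb, laplacianNegPower_weylBasis θ (by positivity)]

theorem laplacianNegPower_mem (hn : n ≠ 0) :
    laplacianNegPower θ ((n : ℝ) / 2) ∈ WeakTrace.weakTraceClass (Hilb θ) := by
  obtain ⟨b, d, hb, hd, hlim⟩ := exists_sorted_basis θ hn
  obtain ⟨C, hC⟩ := hlim.bddAbove_range
  refine WeakTrace.mem_weakTraceClass_of_diagonal b hb (C := C) fun m => ?_
  rw [Complex.norm_real, Real.norm_of_nonneg (hd m), le_div_iff₀ (by positivity), mul_comm]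
  exact hC ⟨m, rfl⟩

/-! ### The trace functional on the noncommutative torus -/

variable {φ : WeakTrace.weakTraceClass (Hilb θ) →ₗ[ℂ] ℂ}

theorem trace_laplacianNegPower (hn : n ≠ 0) (hφ : WeakTrace.IsNormalizedPositiveTrace φ) :
    φ ⟨_, laplacianNegPower_mem θ hn⟩ = ((sphereArea n / n : ℝ) : ℂ) := by
  obtain ⟨b, d, hb, -, hlim⟩ := exists_sorted_basis θ hn
  exact hφ.map_diagonal b hb hlim

/-- The positive functional `a ↦ φ(a Δ^{-n/2})` on `A_θ`. -/
def traceFunctional (hn : n ≠ 0) (hφ : WeakTrace.IsNormalizedPositiveTrace φ) :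
    NCTorus θ →ₚ[ℂ] ℂ :=
  .mk₀ { toFun := fun a => φ ⟨leftMul θ a ∘L laplacianNegPower θ ((n : ℝ) / 2),
            WeakTrace.comp_left_mem _ (laplacianNegPower_mem θ hn)⟩
         map_add' := fun a b => by
          rw [← map_add]
          congr 1
          ext1
          simp [ContinuousLinearMap.add_comp]
         map_smul' := fun c a => by
          rw [RingHom.id_apply, ← map_smul]
          congr 1
          ext1
          simp [ContinuousLinearMap.smul_comp] } fun a ha => by
    obtain ⟨b, rfl⟩ := CStarAlgebra.nonneg_iff_eq_star_mul_self.1 ha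
    -- Cyclicity turns `φ(b* b Δ^{-n/2})` into `φ(b Δ^{-n/2} b*)`, the trace of a positive operator.
    have h1 := hφ.map_comp_comm (leftMul θ (star b))
      ⟨_, WeakTrace.comp_left_mem (leftMul θ b) (laplacianNegPower_mem θ hn)⟩
    have h2 := (isPositive_laplacianNegPower θ (s := (n : ℝ) / 2)
      (by positivity)).conj_adjoint (leftMul θ b)
    have h3 := hφ.nonneg ⟨_, WeakTrace.comp_right_mem (leftMul θ (star b))
      (WeakTrace.comp_left_mem (leftMul θ b) (laplacianNegPower_mem θ hn))⟩ (by
        rw [map_star, ContinuousLinearMap.star_eq_adjoint]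
        exact h2)
    rw [← h1] at h3
    refine h3.trans_eq (congrArg φ (Subtype.ext ?_))
    change leftMul θ (star b) ∘L (leftMul θ b ∘L _) = leftMul θ (star b * b) ∘L _
    rw [map_mul]
    rfl

theorem traceFunctional_apply (hn : n ≠ 0) (hφ : WeakTrace.IsNormalizedPositiveTrace φ)
    (a : NCTorus θ) : traceFunctional θ hn hφ a =
      φ ⟨leftMul θ a ∘L laplacianNegPower θ ((n : ℝ) / 2),
            WeakTrace.comp_left_mem _ (laplacianNegPower_mem θ hn)⟩ := rfl

/-- The translations of `𝕋ⁿ` act on `ℋ_θ`. -/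
theorem exists_translation (t : UnitAddTorus (Fin n)) : ∃ V : Hilb θ →L[ℂ] Hilb θ,
    ∀ k, V (weylBasis θ k) = mFourier k t • weylBasis θ k :=
  (weylBasis θ).exists_diagonal (fun k => mFourier k t) (C := 1)
    fun k => (norm_mFourier_apply k t).le

theorem mFourier_mul_neg (k : Fin n → ℤ) (t : UnitAddTorus (Fin n)) :
    mFourier k t * mFourier k (-t) = 1 := by
  rw [← mFourier_apply_add, add_neg_cancel, mFourier_apply_zero]

/-- Otherwise `e_k = e_0`, against the linear independence of the characters. -/
theorem exists_mFourier_ne_one {k : Fin n → ℤ} (hk : k ≠ 0) :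
    ∃ t : UnitAddTorus (Fin n), mFourier k t ≠ 1 := by
  by_contra! h
  have h1 : mFourier k = mFourier (0 : Fin n → ℤ) := by
    ext t
    rw [h, mFourier_zero, ContinuousMap.one_apply]
  exact hk ((orthonormal_mFourier (d := Fin n)).linearIndependent.injective
    (congrArg (ContinuousMap.toLp 2 (haar n) ℂ) h1))

/-- Conjugation by a translation commutes with `Δ^{-n/2}` and multiplies `W_k` by `e_k(t)`. A trace
ignores conjugation, so the value equals `e_k(t)` times itself, and `t` can be chosen with `e_k(t) ≠
1`. -/
theorem traceFunctional_weyl (hn : n ≠ 0) (hφ : WeakTrace.IsNormalizedPositiveTrace φ)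
    {k : Fin n → ℤ} (hk : k ≠ 0) : traceFunctional θ hn hφ (weyl θ k) = 0 := by
  obtain ⟨t, ht⟩ := exists_mFourier_ne_one hk
  obtain ⟨V, hV⟩ := exists_translation θ t
  obtain ⟨V', hV'⟩ := exists_translation θ (-t)
  have h1 : V' ∘L V = 1 := (weylBasis θ).clm_ext fun l => by
    simp [hV, hV', smul_smul, mFourier_mul_neg]
  have h2 : mFourier k t • (leftMul θ (weyl θ k) ∘L laplacianNegPower θ ((n : ℝ) / 2)) =
      V ∘L (leftMul θ (weyl θ k) ∘L laplacianNegPower θ ((n : ℝ) / 2)) ∘L V' := by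
    refine (weylBasis θ).clm_ext fun l => ?_
    have h3 : mFourier (k + l) t = mFourier k t * mFourier l t := mFourier_add
    simp only [_root_.smul_apply, ContinuousLinearMap.comp_apply, hV', map_smul,
      laplacianNegPower_weylBasis θ (show 0 < (n : ℝ) / 2 by positivity),
      leftMul_weyl_weylBasis, hV, smul_smul, h3]
    congr 1
    linear_combination (-(mFourier k t * negPowerEigenvalue ((n : ℝ) / 2) l *
      mFourier l (weylShift θ k))) * mFourier_mul_neg l t
  have h4 := hφ.map_conj h1 (S := mFourier k t • ⟨_, WeakTrace.comp_left_mem (leftMul θ (weyl θ k))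
    (laplacianNegPower_mem θ hn)⟩) (T := ⟨_, WeakTrace.comp_left_mem (leftMul θ (weyl θ k))
    (laplacianNegPower_mem θ hn)⟩) h2
  rw [map_smul, smul_eq_mul, mul_left_eq_self₀] at h4
  exact h4.resolve_left ht

theorem traceFunctional_eq (hn : n ≠ 0) (hφ : WeakTrace.IsNormalizedPositiveTrace φ)
    (a : NCTorus θ) :
    traceFunctional θ hn hφ a = ((sphereArea n / n : ℝ) : ℂ) * tau θ a := by
  -- Positive functionals on a C*-algebra are automatically continuous, so a comparison on the Weyl
  -- operators suffices.
  let f : NCTorus θ →L[ℂ] ℂ := ⟨(traceFunctional θ hn hφ).toLinearMap,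
    map_continuous (traceFunctional θ hn hφ)⟩
  let g : NCTorus θ →L[ℂ] ℂ := ⟨(tau θ).toLinearMap, map_continuous (tau θ)⟩
  have h : f = ((sphereArea n / n : ℝ) : ℂ) • g := by
    refine clm_ext_weyl θ fun k => ?_
    change traceFunctional θ hn hφ (weyl θ k) = ((sphereArea n / n : ℝ) : ℂ) * tau θ (weyl θ k)
    rw [tau_weyl]
    split_ifs with hk
    · rw [hk, weyl_zero, mul_one, traceFunctional_apply, ← trace_laplacianNegPower θ hn hφ]
      congr 1
      ext1
      change leftMul θ 1 ∘L _ = _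
      rw [map_one]
      rfl
    · rw [traceFunctional_weyl θ hn hφ hk, mul_zero]
  exact congrArg (fun L : NCTorus θ →L[ℂ] ℂ => L a) h

end NCTorus

end

theorem corollary7p3 (n : ℕ) (hn : 2 ≤ n) (θ : Matrix (Fin n) (Fin n) ℝ)
    (hθ : θ.transpose = -θ) (a : NCTorus θ) :
    WeakTrace.IsStronglyMeasurable
        (NCTorus.leftMul θ a ∘L NCTorus.laplacianNegPower θ ((n : ℝ) / 2)) ∧
      WeakTrace.HasNCIntegral
        (NCTorus.leftMul θ a ∘L NCTorus.laplacianNegPower θ ((n : ℝ) / 2))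
        (((sphereArea n / (n : ℝ) : ℝ) : ℂ) * NCTorus.tau θ a) := by
  have hn0 : n ≠ 0 := by omega
  have h : WeakTrace.HasNCIntegral
      (NCTorus.leftMul θ a ∘L NCTorus.laplacianNegPower θ ((n : ℝ) / 2))
      (((sphereArea n / (n : ℝ) : ℝ) : ℂ) * NCTorus.tau θ a) :=
    ⟨WeakTrace.comp_left_mem _ (NCTorus.laplacianNegPower_mem θ hn0),
      fun _ hφ => NCTorus.traceFunctional_eq θ hn0 hφ a⟩
  exact ⟨⟨_, h⟩, h⟩
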